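/- Let $n\ge 0$ be an integer, and call a real $n\times n$ matrix totally positive if all its minors are positive. Let $E_{i,j}$ be the $n\times n$ matrix units and, for a real number $t$, put $x_i(t)=I+tE_{i,i+1}$ and $x_{\bar i}(t)=I+tE_{i+1,i}$ for $1\le i\le n-1$, and $x_{\circ i}(t)=I+(t-1)E_{i,i}$ for $1\le i\le n$. For a word $\mathbf i=(i_1,\dots,i_l)$ in the alphabet consisting of the unbarred letters $1,\dots,n-1$, the circled letters $\circ 1,\dots,\circ n$ and the barred letters $\bar 1,\dots,\overline{n-1}$, define the product map $x_{\mathbf i}(t_1,\dots,t_l)=x_{i_1}(t_1)\cdots x_{i_l}(t_l)$. Let $s_i$ be the transposition of $i$ and $i+1$ in the symmetric group $\mathcal S_n$; a reduced word for $w\in\mathcal S_n$ is a word $(j_1,\dots,j_m)$ of the shortest possible length such that $w=s_{j_1}\cdots s_{j_m}$. Let $w_{\mathrm o}\in\mathcal S_n$ be the order-reversing permutation of $1,\dots,n$. A word $\mathbf i$ in the above alphabet is called a factorization scheme if its unbarred letters, read in order, form a reduced word for $w_{\mathrm o}$, its barred letters, read in order and with the bars removed, form a reduced word for $w_{\mathrm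 o}$, and each circled letter occurs in $\mathbf i$ exactly once. **Theorem.** Every factorization scheme $\mathbf i$ has length $n^2$, and the product map $x_{\mathbf i}$ restricts to a bijection from the set $(\mathbb R_{>0})^{n^2}$ of $n^2$-tuples of positive real numbers onto the set of totally positive $n\times n$ matrices. -/

import Mathlib

namespace TotalPositivity

/-- A real matrix is totally positive if all its minors are positive. -/
def IsTotallyPositive {n : ℕ} (x : Matrix (Fin n) (Fin n) ℝ) : Prop :=
  ∀ (k : ℕ) (rows cols : Fin k ↪o Fin n), 0 < (x.submatrix rows cols).det

/-- The alphabet `1, …, n-1`, circled `1, …, n`, barred `1, …, n-1`; all indices are shifted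
down by one, as usual for `Fin`. -/
inductive Letter (n : ℕ) : Type
  | unbarred (i : Fin (n - 1)) : Letter n
  | circled (i : Fin n) : Letter n
  | barred (i : Fin (n - 1)) : Letter n

/-- The index `i` of the pair `i, i + 1`. -/
def lower {n : ℕ} (i : Fin (n - 1)) : Fin n := ⟨i.1, by omega⟩

/-- The index `i + 1` of the pair `i, i + 1`. -/
def upper {n : ℕ} (i : Fin (n - 1)) : Fin n := ⟨i.1 + 1, by omega⟩

/-- The elementary Jacobi matrix attached to a letter and a parameter: `I + t E_{i,i+1}` for
`i`, `I + (t - 1) E_{i,i}` for circled `i`, and `I + t E_{i+1,i}` for barred `i`. -/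
def elementaryJacobi {n : ℕ} {R : Type*} [CommRing R] :
    Letter n → R → Matrix (Fin n) (Fin n) R
  | .unbarred i, t => 1 + Matrix.single (lower i) (upper i) t
  | .circled i, t => 1 + Matrix.single i i (t - 1)
  | .barred i, t => 1 + Matrix.single (upper i) (lower i) t

/-- The product map `(t_1, …, t_l) ↦ x_{i_1}(t_1) ⋯ x_{i_l}(t_l)` of a word `(i_1, …, i_l)`. -/
def productMap {n : ℕ} {R : Type*} [CommRing R] (w : List (Letter n))
    (t : Fin w.length → R) : Matrix (Fin n) (Fin n) R :=
  (List.ofFn fun k => elementaryJacobi (w.get k) (t k)).prod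

/-- The adjacent transposition `s_i = (i i+1)`. -/
def adjacentSwap {n : ℕ} (i : Fin (n - 1)) : Equiv.Perm (Fin n) :=
  Equiv.swap (lower i) (upper i)

/-- The permutation `s_{j_1} ⋯ s_{j_l}`. -/
def wordPerm {n : ℕ} (j : List (Fin (n - 1))) : Equiv.Perm (Fin n) :=
  (j.map adjacentSwap).prod

/-- A reduced word for `σ`: a word of shortest possible length with product `σ`. -/
def IsReducedWord {n : ℕ} (σ : Equiv.Perm (Fin n)) (j : List (Fin (n - 1))) : Prop :=
  wordPerm j = σ ∧ ∀ j' : List (Fin (n - 1)), wordPerm j' = σ → j.length ≤ j'.length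

/-- The subword of unbarred letters. -/
def unbarredPart {n : ℕ} (w : List (Letter n)) : List (Fin (n - 1)) :=
  w.filterMap fun | .unbarred i => some i | _ => none

/-- The subword of barred letters. -/
def barredPart {n : ℕ} (w : List (Letter n)) : List (Fin (n - 1)) :=
  w.filterMap fun | .barred i => some i | _ => none

/-- The subword of circled letters. -/
def circledPart {n : ℕ} (w : List (Letter n)) : List (Fin n) :=
  w.filterMap fun | .circled i => some i | _ => none

/-- A factorization scheme: a shuffle of two reduced words (one unbarred, one barred) for the
order-reversing permutation and of the circled letters, each taken exactly once. -/
structure IsFactorizationScheme {n : ℕ} (w : List (Letter n)) : Prop where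
  unbarred_reduced : IsReducedWord Fin.revPerm (unbarredPart w)
  barred_reduced : IsReducedWord Fin.revPerm (barredPart w)
  circled_once : ∀ i : Fin n, (circledPart w).count i = 1

end TotalPositivity

/-!
The argument works in the monoid `FamilyClass M` of families of elements of a monoid `M`, taken up
to bijective reparametrization, with the products of members as multiplication. A word in the
alphabet gives the product of the classes of its letters with positive parameters, and this is the
class of its product map on positive tuples (`prod_map_letterClass`). The theorem says that, for a
factorization scheme, this class is that of the inclusion of the set of totally positive matrices.

The commutation relations between elementary Jacobi matrices come with subtraction-free, invertible
changes of the parameters, so they become plain identities between the classes of the letters: the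
circled letters are central, the unbarred and the barred letters satisfy the braid relations, and
an unbarred letter commutes with a barred one in the presence of all circled letters, which absorb
the diagonal factor. Together with Matsumoto's theorem for the symmetric group
(`prod_map_eq_of_reduced`) this shows that all schemes have the same class
(`IsFactorizationScheme.prod_map_letterClass`).

It remains to treat one scheme, and the standard one is built so that it matches one round of
Neville elimination (`bijective_elimination`): a totally positive matrix of size `m + 1` is, in a
unique way, a run of row operations and a run of column operations applied to the block sum of a
positive number and a totally positive matrix of size `m`. The result is totally positive because
each of its minors dominates a positive multiple of the minor of the block sum whose first row and
column indices are pulled down to the first row and column (`det_mul_upperRun_pos`). Conversely, elimination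
preserves the positivity of the initial minors, and these suffice for total positivity
(`isTotallyPositive_of_isColumnInitialPos`).
-/

namespace TotalPositivity

/-! ### Reduced words in the symmetric group -/

/-- The inversions of a permutation, as pairs `a < b` of positions. -/
def inversions {n : ℕ} (σ : Equiv.Perm (Fin n)) : Finset (Fin n × Fin n) :=
  Finset.univ.filter fun p => p.1 < p.2 ∧ σ p.2 < σ p.1

lemma mem_inversions {n : ℕ} {σ : Equiv.Perm (Fin n)} {p : Fin n × Fin n} :
    p ∈ inversions σ ↔ p.1 < p.2 ∧ σ p.2 < σ p.1 := by
  simp [inversions]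

lemma lower_lt_upper {n : ℕ} (i : Fin (n - 1)) : lower i < upper i := by
  simp [lower, upper, Fin.lt_def]

lemma adjacentSwap_lower {n : ℕ} (i : Fin (n - 1)) : adjacentSwap i (lower i) = upper i :=
  Equiv.swap_apply_left _ _

lemma adjacentSwap_upper {n : ℕ} (i : Fin (n - 1)) : adjacentSwap i (upper i) = lower i :=
  Equiv.swap_apply_right _ _

lemma adjacentSwap_apply_self {n : ℕ} (i : Fin (n - 1)) (a : Fin n) :
    adjacentSwap i (adjacentSwap i a) = a :=
  Equiv.swap_apply_self _ _ _

lemma adjacentSwap_mul_self {n : ℕ} (i : Fin (n - 1)) : adjacentSwap i * adjacentSwap i = 1 :=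
  Equiv.swap_mul_self _ _

lemma adjacentSwap_lt {n : ℕ} {i : Fin (n - 1)} {a b : Fin n} (h : a < b)
    (hne : ¬(a = lower i ∧ b = upper i)) : adjacentSwap i a < adjacentSwap i b := by
  simp only [adjacentSwap, Equiv.swap_apply_def, lower, upper, Fin.ext_iff, Fin.lt_def] at *
  split_ifs <;> (try dsimp only) <;> omega

/-- Right multiplication by an adjacent transposition shortens a permutation at a descent: the
transposition maps the inversions of the product bijectively to those of `σ`, without the descent. -/
lemma card_inversions_mul_adjacentSwap {n : ℕ} (σ : Equiv.Perm (Fin n)) (i : Fin (n - 1))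
    (h : σ (upper i) < σ (lower i)) :
    (inversions (σ * adjacentSwap i)).card + 1 = (inversions σ).card := by
  have hmem : (lower i, upper i) ∈ inversions σ := mem_inversions.2 ⟨lower_lt_upper i, h⟩
  rw [← Finset.card_erase_add_one hmem]
  congr 1
  refine Finset.card_nbij' (fun p => (adjacentSwap i p.1, adjacentSwap i p.2))
    (fun p => (adjacentSwap i p.1, adjacentSwap i p.2)) ?_ ?_ ?_ ?_
  · rintro ⟨a, b⟩ hp
    obtain ⟨hab, hσ⟩ := mem_inversions.1 hp
    simp only [Equiv.Perm.mul_apply] at hab hσ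
    have hne : ¬(a = lower i ∧ b = upper i) := by
      rintro ⟨rfl, rfl⟩
      rw [adjacentSwap_lower, adjacentSwap_upper] at hσ
      exact absurd hσ h.asymm
    have hlt := adjacentSwap_lt hab hne
    refine Finset.mem_coe.2 (Finset.mem_erase.2 ⟨?_, mem_inversions.2 ⟨hlt, hσ⟩⟩)
    intro he
    obtain ⟨h1, h2⟩ := Prod.ext_iff.1 he
    have h1' := congrArg (adjacentSwap i) h1
    have h2' := congrArg (adjacentSwap i) h2
    simp only [adjacentSwap_apply_self, adjacentSwap_lower, adjacentSwap_upper] at h1' h2'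
    rw [h1', h2'] at hab
    exact absurd hab (lower_lt_upper i).asymm
  · rintro ⟨a, b⟩ hp
    obtain ⟨hne, hp⟩ := Finset.mem_erase.1 (Finset.mem_coe.1 hp)
    obtain ⟨hab, hσ⟩ := mem_inversions.1 hp
    refine Finset.mem_coe.2 (mem_inversions.2 ⟨adjacentSwap_lt hab ?_, ?_⟩)
    · rintro ⟨rfl, rfl⟩
      exact hne rfl
    · simpa [Equiv.Perm.mul_apply, adjacentSwap_apply_self] using hσ
  · rintro ⟨a, b⟩ _
    simp [adjacentSwap_apply_self]
  · rintro ⟨a, b⟩ _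
    simp [adjacentSwap_apply_self]

lemma mul_adjacentSwap_cancel {n : ℕ} (σ : Equiv.Perm (Fin n)) (i : Fin (n - 1)) :
    σ * adjacentSwap i * adjacentSwap i = σ := by
  rw [mul_assoc, adjacentSwap_mul_self, mul_one]

/-- Right multiplication by an adjacent transposition lengthens a permutation at an ascent. -/
lemma card_inversions_mul_adjacentSwap_of_lt {n : ℕ} (σ : Equiv.Perm (Fin n)) (i : Fin (n - 1))
    (h : σ (lower i) < σ (upper i)) :
    (inversions (σ * adjacentSwap i)).card = (inversions σ).card + 1 := by
  have := card_inversions_mul_adjacentSwap (σ * adjacentSwap i) i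
    (by simpa [Equiv.Perm.mul_apply, adjacentSwap_lower, adjacentSwap_upper] using h)
  rw [mul_adjacentSwap_cancel] at this
  exact this.symm

lemma lt_or_gt_lower_upper {n : ℕ} (σ : Equiv.Perm (Fin n)) (i : Fin (n - 1)) :
    σ (lower i) < σ (upper i) ∨ σ (upper i) < σ (lower i) :=
  lt_or_gt_of_ne fun h => (lower_lt_upper i).ne (σ.injective h)

@[simp] lemma wordPerm_append {n : ℕ} (a b : List (Fin (n - 1))) :
    wordPerm (a ++ b) = wordPerm a * wordPerm b := by
  simp [wordPerm]

@[simp] lemma wordPerm_singleton {n : ℕ} (i : Fin (n - 1)) : wordPerm [i] = adjacentSwap i := by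
  simp [wordPerm]

@[simp] lemma wordPerm_nil {n : ℕ} : wordPerm ([] : List (Fin (n - 1))) = 1 := rfl

lemma wordPerm_reverse {n : ℕ} (a : List (Fin (n - 1))) :
    wordPerm a.reverse = (wordPerm a)⁻¹ := by
  simp [wordPerm, List.prod_inv_reverse, List.map_reverse, Function.comp_def,
    show ∀ i : Fin (n - 1), (adjacentSwap i)⁻¹ = adjacentSwap i from fun _ => Equiv.swap_inv _ _]

lemma card_inversions_wordPerm_le {n : ℕ} (a : List (Fin (n - 1))) :
    (inversions (wordPerm a)).card ≤ a.length := by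
  induction a using List.reverseRecOn with
  | nil =>
    simp only [wordPerm_nil, List.length_nil, Nat.le_zero, Finset.card_eq_zero,
      Finset.eq_empty_iff_forall_notMem, mem_inversions]
    exact fun p hp => absurd hp.1 hp.2.asymm
  | append_singleton a i ih =>
    rw [wordPerm_append, wordPerm_singleton, List.length_append, List.length_singleton]
    rcases lt_or_gt_lower_upper (wordPerm a) i with h | h
    · rw [card_inversions_mul_adjacentSwap_of_lt _ _ h]
      omega
    · have := card_inversions_mul_adjacentSwap _ _ h
      omega

lemma eq_one_of_forall_lower_lt_upper {n : ℕ} (σ : Equiv.Perm (Fin n))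
    (h : ∀ i, σ (lower i) < σ (upper i)) : σ = 1 := by
  cases n with
  | zero => exact Subsingleton.elim _ _
  | succ m =>
    have hm : StrictMono σ := Fin.strictMono_iff_lt_succ.2 fun i => h i
    have : (hm.orderIsoOfSurjective σ σ.surjective) = OrderIso.refl _ := Subsingleton.elim _ _
    ext a
    exact congrArg Fin.val (DFunLike.congr_fun this a)

lemma exists_word_length_eq_card_inversions {n : ℕ} (σ : Equiv.Perm (Fin n)) :
    ∃ a : List (Fin (n - 1)), wordPerm a = σ ∧ a.length = (inversions σ).card := by
  induction hN : (inversions σ).card generalizing σ with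
  | zero =>
    refine ⟨[], ?_, rfl⟩
    refine (eq_one_of_forall_lower_lt_upper σ fun i => ?_).symm
    refine (lt_or_gt_lower_upper σ i).resolve_right fun h => ?_
    have := card_inversions_mul_adjacentSwap _ _ h
    omega
  | succ N ih =>
    have : ∃ i, σ (upper i) < σ (lower i) := by
      by_contra! hno
      have h1 := eq_one_of_forall_lower_lt_upper σ fun i =>
        (lt_or_gt_lower_upper σ i).resolve_right (hno i).not_gt
      have := card_inversions_wordPerm_le ([] : List (Fin (n - 1)))
      rw [wordPerm_nil, ← h1, hN] at this
      simp at this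
    obtain ⟨i, hi⟩ := this
    have hc := card_inversions_mul_adjacentSwap _ _ hi
    obtain ⟨a, ha, hl⟩ := ih (σ * adjacentSwap i) (by omega)
    refine ⟨a ++ [i], ?_, by simp [hl]⟩
    rw [wordPerm_append, wordPerm_singleton, ha, mul_adjacentSwap_cancel]

lemma isReducedWord_iff {n : ℕ} {σ : Equiv.Perm (Fin n)} {a : List (Fin (n - 1))} :
    IsReducedWord σ a ↔ wordPerm a = σ ∧ a.length = (inversions σ).card := by
  constructor
  · rintro ⟨rfl, hmin⟩
    obtain ⟨b, hb, hl⟩ := exists_word_length_eq_card_inversions (wordPerm a)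
    exact ⟨rfl, le_antisymm (hl ▸ hmin b hb) (card_inversions_wordPerm_le a)⟩
  · rintro ⟨rfl, hl⟩
    exact ⟨rfl, fun b hb => hl ▸ hb ▸ card_inversions_wordPerm_le b⟩

lemma card_inversions_revPerm (n : ℕ) :
    (inversions (Fin.revPerm : Equiv.Perm (Fin n))).card = n.choose 2 := by
  have h : ∀ b : Fin n, (Finset.univ.filter fun a : Fin n => a < b).card = b.1 := fun b => by
    rw [← Fin.card_Iio b]
    congr 1
    ext a
    simp
  rw [inversions, Finset.card_filter, Fintype.sum_prod_type_right, Nat.choose_two_right,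
    ← Finset.sum_range_id, ← Fin.sum_univ_eq_sum_range (fun i => i)]
  refine Finset.sum_congr rfl fun b _ => ?_
  rw [← h b, Finset.card_filter]
  simp [Fin.rev_lt_rev]

lemma adjacentSwap_mul_comm {n : ℕ} {i j : Fin (n - 1)} (h : i.1 + 1 < j.1) :
    adjacentSwap i * adjacentSwap j = adjacentSwap j * adjacentSwap i := by
  refine (Equiv.Perm.disjoint_iff_disjoint_support.2 ?_).commute
  simp only [adjacentSwap, Equiv.Perm.support_swap (lower_lt_upper _).ne]
  simp [lower, upper, Fin.ext_iff]
  omega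

lemma adjacentSwap_braid {n : ℕ} {i j : Fin (n - 1)} (h : i.1 + 1 = j.1) :
    adjacentSwap i * adjacentSwap j * adjacentSwap i =
      adjacentSwap j * adjacentSwap i * adjacentSwap j := by
  have hl : lower j = upper i := Fin.ext h.symm
  have h1 : lower i ≠ upper i := (lower_lt_upper i).ne
  have h2 : upper i ≠ upper j := hl ▸ (lower_lt_upper j).ne
  have h3 : lower i ≠ upper j := ((lower_lt_upper i).trans (hl ▸ lower_lt_upper j)).ne
  rw [adjacentSwap, adjacentSwap, hl]
  ext a
  simp only [Equiv.Perm.mul_apply, Equiv.swap_apply_def]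
  split_ifs <;> simp_all

/-- Matsumoto's theorem for the symmetric group: if elements of a monoid satisfy the braid
relations, then their products along two reduced words of the same permutation agree. The two
last letters `i`, `j` are right descents; if they differ, the permutation also has a reduced word
which ends in the longest word in `s_i` and `s_j`, and this word can be compared with both. -/
theorem prod_map_eq_of_reduced {n : ℕ} {Q : Type*} [Monoid Q] (f : Fin (n - 1) → Q)
    (hcomm : ∀ i j : Fin (n - 1), i.1 + 1 < j.1 → f i * f j = f j * f i)
    (hbraid : ∀ i j : Fin (n - 1), i.1 + 1 = j.1 → f i * f j * f i = f j * f i * f j)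
    (a b : List (Fin (n - 1))) (hab : wordPerm a = wordPerm b)
    (ha : a.length = (inversions (wordPerm a)).card)
    (hb : b.length = (inversions (wordPerm b)).card) :
    (a.map f).prod = (b.map f).prod := by
  induction hN : a.length using Nat.strong_induction_on generalizing a b with
  | _ N ih =>
  have hlen : b.length = N := by rw [hb, ← hab, ← ha, hN]
  rcases List.eq_nil_or_concat a with rfl | ⟨a', i, rfl⟩
  · obtain rfl : b = [] := List.eq_nil_of_length_eq_zero (by simpa [← hN] using hlen)
    rfl
  rcases List.eq_nil_or_concat b with rfl | ⟨b', j, rfl⟩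
  · simp [← hlen] at hN
  simp only [List.concat_eq_append, List.length_append, List.length_singleton, wordPerm_append,
    wordPerm_singleton, List.map_append, List.prod_append, List.map_singleton,
    List.prod_singleton] at *
  set σ := wordPerm a' * adjacentSwap i with hσ
  rw [← hab] at hb
  -- the last letter of a reduced word is a descent
  have key : ∀ (c : List (Fin (n - 1))) (k : Fin (n - 1)), wordPerm c * adjacentSwap k = σ →
      c.length + 1 = (inversions σ).card → σ (upper k) < σ (lower k) ∧
        wordPerm c = σ * adjacentSwap k ∧ c.length = (inversions (wordPerm c)).card := by
    intro c k hc hl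
    have h1 : wordPerm c = σ * adjacentSwap k := by rw [← hc, mul_adjacentSwap_cancel]
    have hle := card_inversions_wordPerm_le c
    rcases lt_or_gt_lower_upper σ k with h | h
    · have := card_inversions_mul_adjacentSwap_of_lt _ _ h
      rw [← h1] at this
      omega
    · have := card_inversions_mul_adjacentSwap _ _ h
      rw [← h1] at this
      exact ⟨h, h1, by omega⟩
  obtain ⟨hi, ha1, ha2⟩ := key a' i rfl ha
  obtain ⟨hj, hb1, hb2⟩ := key b' j hab.symm hb
  -- comparison of words with last letters `i < j`
  have main : ∀ (a' b' : List (Fin (n - 1))) (i j : Fin (n - 1)), i.1 < j.1 →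
      a'.length + 1 = N → b'.length + 1 = N →
      σ (upper i) < σ (lower i) → wordPerm a' = σ * adjacentSwap i →
      a'.length = (inversions (wordPerm a')).card →
      σ (upper j) < σ (lower j) → wordPerm b' = σ * adjacentSwap j →
      b'.length = (inversions (wordPerm b')).card →
      (a'.map f).prod * f i = (b'.map f).prod * f j := by
    clear * - ih hcomm hbraid
    clear_value σ
    intro a b i j hij haN hbN hi ha1 ha2 hj hb1 hb2
    have li := card_inversions_mul_adjacentSwap _ _ hi
    rw [← ha1] at li
    rcases Nat.lt_or_ge (i.1 + 1) j.1 with hlt | hge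
    -- `s_i` and `s_j` commute: compare with `c s_j` and `c s_i`
    · have hfix : ∀ x : Fin n, x.1 ≠ i.1 → x.1 ≠ i.1 + 1 → adjacentSwap i x = x := fun x h1 h2 =>
        Equiv.swap_apply_of_ne_of_ne (by simpa [Fin.ext_iff, lower] using h1)
          (by simpa [Fin.ext_iff, upper] using h2)
      have hd : (σ * adjacentSwap i) (upper j) < (σ * adjacentSwap i) (lower j) := by
        rw [Equiv.Perm.mul_apply, Equiv.Perm.mul_apply, hfix _ (by simp [upper]; omega)
          (by simp [upper]; omega), hfix _ (by simp [lower]; omega) (by simp [lower]; omega)]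
        exact hj
      have l2 := card_inversions_mul_adjacentSwap _ _ hd
      obtain ⟨c, hc, hcl⟩ := exists_word_length_eq_card_inversions
        (σ * adjacentSwap i * adjacentSwap j)
      rw [← ha1] at l2
      have hcN : c.length + 1 = a.length := by rw [hcl, ← ha1]; omega
      have ea : wordPerm (c ++ [j]) = wordPerm a := by
        rw [wordPerm_append, wordPerm_singleton, hc, mul_adjacentSwap_cancel, ha1]
      have eb : wordPerm (c ++ [i]) = wordPerm b := by
        rw [wordPerm_append, wordPerm_singleton, hc, hb1, mul_assoc σ, adjacentSwap_mul_comm hlt,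
          ← mul_assoc, mul_adjacentSwap_cancel]
      have pa := ih a.length (by omega) a (c ++ [j]) ea.symm ha2
        (by rw [ea, ← ha2]; simpa using hcN) rfl
      have pb := ih b.length (by omega) b (c ++ [i]) eb.symm hb2
        (by rw [eb, ← hb2]; simp; omega) rfl
      simp only [List.map_append, List.prod_append, List.map_singleton, List.prod_singleton]
        at pa pb
      rw [pa, pb, mul_assoc, mul_assoc, hcomm i j hlt]
    -- neighbouring letters: compare with `c s_i s_j` and `c s_j s_i`
    · have hij1 : i.1 + 1 = j.1 := by omega
      have hl : lower j = upper i := Fin.ext hij1.symm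
      have hfix : adjacentSwap i (upper j) = upper j := Equiv.swap_apply_of_ne_of_ne
          (by simp [Fin.ext_iff, lower, upper]; omega) (by simp [Fin.ext_iff, upper]; omega)
      have hfix' : adjacentSwap j (lower i) = lower i := Equiv.swap_apply_of_ne_of_ne
          (by simp [Fin.ext_iff, lower]; omega) (by simp [Fin.ext_iff, lower, upper]; omega)
      have hd : (σ * adjacentSwap i) (upper j) < (σ * adjacentSwap i) (lower j) := by
        rw [Equiv.Perm.mul_apply, Equiv.Perm.mul_apply, hfix, hl, adjacentSwap_upper]
        exact (hl ▸ hj).trans hi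
      have l2 := card_inversions_mul_adjacentSwap _ _ hd
      have hd' : (σ * adjacentSwap i * adjacentSwap j) (upper i) <
          (σ * adjacentSwap i * adjacentSwap j) (lower i) := by
        simp only [Equiv.Perm.mul_apply]
        rw [← hl, adjacentSwap_lower, hfix, hfix', adjacentSwap_lower, ← hl]
        exact hj
      have l3 := card_inversions_mul_adjacentSwap _ _ hd'
      obtain ⟨c, hc, hcl⟩ := exists_word_length_eq_card_inversions
        (σ * adjacentSwap i * adjacentSwap j * adjacentSwap i)
      rw [← ha1] at l2 l3
      have hcN : c.length + 2 = a.length := by rw [hcl, ← ha1]; omega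
      have ea : wordPerm (c ++ [i] ++ [j]) = wordPerm a := by
        rw [wordPerm_append, wordPerm_append, wordPerm_singleton, wordPerm_singleton, hc,
          mul_adjacentSwap_cancel, mul_adjacentSwap_cancel, ha1]
      have eb : wordPerm (c ++ [j] ++ [i]) = wordPerm b := by
        rw [wordPerm_append, wordPerm_append, wordPerm_singleton, wordPerm_singleton, hc, hb1,
          mul_assoc σ, mul_assoc σ, adjacentSwap_braid hij1, ← mul_assoc, ← mul_assoc,
          mul_adjacentSwap_cancel, mul_adjacentSwap_cancel]
      have pa := ih a.length (by omega) a (c ++ [i] ++ [j]) ea.symm ha2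
        (by rw [ea, ← ha2]; simpa using hcN) rfl
      have pb := ih b.length (by omega) b (c ++ [j] ++ [i]) eb.symm hb2
        (by rw [eb, ← hb2]; simp; omega) rfl
      simp only [List.map_append, List.prod_append, List.map_singleton, List.prod_singleton]
        at pa pb
      rw [pa, pb, mul_assoc, mul_assoc, mul_assoc, mul_assoc, ← mul_assoc (f i),
        ← mul_assoc (f j), hbraid i j hij1]
  rcases lt_trichotomy i.1 j.1 with h | h | h
  · exact main a' b' i j h hN hlen hi ha1 ha2 hj hb1 hb2
  · obtain rfl : i = j := Fin.ext h
    rw [ih a'.length (by omega) a' b' (ha1.trans hb1.symm) ha2 hb2 rfl]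
  · exact (main b' a' j i h hlen hN hj hb1 hb2 hi ha1 ha2).symm

/-- The reduced word `(m-1) (m-2, m-1) ⋯ (0, 1, …, m-1)` of the order-reversing permutation in size
`m + 1`. Removing the final run leaves the word for one size less, with letters shifted by one. -/
def standardWord : (n : ℕ) → List (Fin (n - 1))
  | 0 => []
  | m + 1 => (standardWord m).map (fun i => ⟨i.1 + 1, by omega⟩) ++
      List.ofFn (fun i : Fin m => ⟨i.1, by omega⟩)

lemma length_standardWord (n : ℕ) : (standardWord n).length = n.choose 2 := by
  induction n with
  | zero => rfl
  | succ m ih => simp [standardWord, ih, Nat.choose_succ_succ, add_comm]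

/-- Shifting all letters of a word by one gives a permutation which fixes `0`. -/
lemma wordPerm_map_shift {m : ℕ} (a : List (Fin (m - 1))) :
    wordPerm (n := m + 1) (a.map fun i => ⟨i.1 + 1, by omega⟩) 0 = 0 ∧
    ∀ k : Fin m, wordPerm (n := m + 1) (a.map fun i => ⟨i.1 + 1, by omega⟩) k.succ =
      (wordPerm a k).succ := by
  induction a with
  | nil => exact ⟨rfl, fun _ => rfl⟩
  | cons i a ih =>
    have e : ∀ (n : ℕ) (i : Fin (n - 1)) (a : List (Fin (n - 1))) (k : Fin n),
      wordPerm (i :: a) k = adjacentSwap i (wordPerm a k) := fun _ _ _ _ => rfl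
    simp only [List.map_cons, e, ih]
    constructor
    · exact Equiv.swap_apply_of_ne_of_ne (by simp [lower, Fin.ext_iff])
        (by simp [upper, Fin.ext_iff])
    · intro k
      simp only [adjacentSwap, Equiv.swap_apply_def, lower, upper, Fin.ext_iff, Fin.val_succ]
      split_ifs <;> simp_all

/-- The permutation `s_0 s_1 ⋯ s_{k-1}` is the cycle `0 ↦ 1 ↦ ⋯ ↦ k ↦ 0`. -/
lemma wordPerm_run {m k : ℕ} (hk : k ≤ m) (a : Fin (m + 1)) :
    (wordPerm (n := m + 1) (List.ofFn fun i : Fin k => ⟨i.1, by omega⟩) a).1 =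
      if a.1 < k then a.1 + 1 else if a.1 = k then 0 else a.1 := by
  induction k generalizing a with
  | zero =>
    refine (show _ = a.1 from rfl).trans ?_
    split_ifs <;> omega
  | succ k ih =>
    rw [List.ofFn_succ', List.concat_eq_append, wordPerm_append, wordPerm_singleton,
      Equiv.Perm.mul_apply]
    refine (ih (by omega) _).trans ?_
    simp only [adjacentSwap, Equiv.swap_apply_def, lower, upper, Fin.ext_iff, Fin.val_last]
    split_ifs <;> simp_all <;> omega

lemma wordPerm_standardWord (n : ℕ) : wordPerm (standardWord n) = Fin.revPerm := by
  induction n with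
  | zero => exact Subsingleton.elim _ _
  | succ m ih =>
    ext a
    rw [standardWord, wordPerm_append, Equiv.Perm.mul_apply]
    have h := wordPerm_run le_rfl a
    obtain ⟨h0, hs⟩ := wordPerm_map_shift (standardWord m)
    generalize wordPerm (n := m + 1) (List.ofFn fun i : Fin m => ⟨i.1, by omega⟩) a = b at h
    rw [ih] at hs
    induction b using Fin.cases with
    | zero =>
      rw [h0]
      simp at h ⊢
      split_ifs at h <;> omega
    | succ k =>
      rw [hs]
      simp [Fin.val_rev] at h ⊢
      split_ifs at h <;> omega

/-! ### Families of monoid elements up to reparametrization -/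

/-- A family of elements of `M`: a parameter type with a map to `M`. -/
def Family (M : Type) : Type 1 := Σ X : Type, X → M

/-- Two families are equivalent if they differ by a bijection of the parameters. -/
instance familySetoid (M : Type) : Setoid (Family M) where
  r f g := ∃ e : f.1 ≃ g.1, ∀ x, g.2 (e x) = f.2 x
  iseqv :=
    { refl := fun _ => ⟨Equiv.refl _, fun _ => rfl⟩
      symm := fun ⟨e, he⟩ => ⟨e.symm, fun x => by rw [← he, e.apply_symm_apply]⟩
      trans := fun ⟨e, he⟩ ⟨e', he'⟩ => ⟨e.trans e', fun x => (he' _).trans (he x)⟩ }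

/-- Families of elements of `M` up to reparametrization. The class of a family records how often
each element of `M` is attained. -/
def FamilyClass (M : Type) : Type 1 := Quotient (familySetoid M)

namespace FamilyClass

/-- The class of the family `f`. -/
def mk {M X : Type} (f : X → M) : FamilyClass M := Quotient.mk _ ⟨X, f⟩

lemma mk_eq_mk_iff {M X Y : Type} {f : X → M} {g : Y → M} :
    mk f = mk g ↔ ∃ e : X ≃ Y, ∀ x, g (e x) = f x :=
  Quotient.eq

lemma mk_eq_mk {M X Y : Type} {f : X → M} {g : Y → M} (e : X ≃ Y) (h : ∀ x, g (e x) = f x) :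
    mk f = mk g :=
  mk_eq_mk_iff.2 ⟨e, h⟩

/-- The product of two families is the family of products of their members, with independent
parameters. -/
instance {M : Type} [Monoid M] : Monoid (FamilyClass M) where
  mul := Quotient.map₂ (fun f g => ⟨f.1 × g.1, fun p => f.2 p.1 * g.2 p.2⟩)
    fun _ _ ⟨e, he⟩ _ _ ⟨e', he'⟩ =>
      ⟨e.prodCongr e', fun p => congrArg₂ (· * ·) (he p.1) (he' p.2)⟩
  one := mk fun _ : Unit => 1
  mul_assoc := by
    rintro ⟨f⟩ ⟨g⟩ ⟨h⟩
    exact Quotient.sound ⟨Equiv.prodAssoc _ _ _, fun _ => (mul_assoc _ _ _).symm⟩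
  one_mul := by
    rintro ⟨f⟩
    exact Quotient.sound ⟨Equiv.punitProd _, fun _ => (one_mul _).symm⟩
  mul_one := by
    rintro ⟨f⟩
    exact Quotient.sound ⟨Equiv.prodPUnit _, fun _ => (mul_one _).symm⟩

lemma mk_mul_mk {M X Y : Type} [Monoid M] (f : X → M) (g : Y → M) :
    mk f * mk g = mk fun p : X × Y => f p.1 * g p.2 :=
  rfl

lemma one_def {M : Type} [Monoid M] : (1 : FamilyClass M) = mk fun _ : Unit => 1 := rfl

/-- The image of a family under a monoid homomorphism. -/
def map {M N : Type} [Monoid M] [Monoid N] (φ : M →* N) : FamilyClass M →* FamilyClass N where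
  toFun := Quotient.map (fun f => ⟨f.1, fun x => φ (f.2 x)⟩)
    fun _ _ ⟨e, he⟩ => ⟨e, fun x => congrArg φ (he x)⟩
  map_one' := congrArg (mk (X := Unit)) (funext fun _ => φ.map_one)
  map_mul' := by
    rintro ⟨f⟩ ⟨g⟩
    exact congrArg (mk (X := f.1 × g.1)) (funext fun _ => φ.map_mul _ _)

lemma map_mk {M N X : Type} [Monoid M] [Monoid N] (φ : M →* N) (f : X → M) :
    map φ (mk f) = mk fun x => φ (f x) :=
  rfl

/-- A product of `k` families is the family of products indexed by `k`-tuples of parameters. -/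
lemma prod_ofFn_mk {M X : Type} [Monoid M] {k : ℕ} (f : Fin k → X → M) :
    (List.ofFn fun i => mk (f i)).prod =
      mk fun t : Fin k → X => (List.ofFn fun i => f i (t i)).prod := by
  induction k with
  | zero =>
    rw [List.ofFn_zero, List.prod_nil, one_def]
    exact mk_eq_mk (Equiv.ofUnique _ _) fun _ => by simp
  | succ k ih =>
    rw [List.ofFn_succ, List.prod_cons, ih, mk_mul_mk]
    exact mk_eq_mk (Fin.consEquiv fun _ => X) fun p => by
      simp [List.ofFn_succ, Fin.consEquiv]

end FamilyClass

open FamilyClass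

/-! ### Relations between elementary Jacobi matrices -/

/-- The positive real numbers. -/
abbrev Pos : Type := {t : ℝ // 0 < t}

/-- The class of the one-parameter family of elementary Jacobi matrices of a letter, with positive
parameter. -/
def letterClass {n : ℕ} (l : Letter n) : FamilyClass (Matrix (Fin n) (Fin n) ℝ) :=
  mk fun t : Pos => elementaryJacobi l t.1

/-- The product of the classes of the letters of `w` is the class of the product map of `w` on
tuples of positive parameters. -/
lemma prod_map_letterClass {n : ℕ} (w : List (Letter n)) :
    (w.map letterClass).prod =
      mk fun t : {t : Fin w.length → ℝ // ∀ k, 0 < t k} => productMap w t.1 := by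
  have : w.map letterClass = List.ofFn fun k => letterClass (w.get k) := by
    conv_lhs => rw [← List.ofFn_get w, List.map_ofFn]
    rfl
  rw [this]
  refine (prod_ofFn_mk _).trans ?_
  exact mk_eq_mk (Equiv.subtypePiEquivPi (p := fun _ (t : ℝ) => 0 < t)).symm fun _ => rfl

lemma elementaryJacobi_circled {n : ℕ} (i : Fin n) (t : ℝ) :
    elementaryJacobi (.circled i) t = Matrix.diagonal (Function.update 1 i t) := by
  ext a b
  simp only [elementaryJacobi, Matrix.add_apply, Matrix.one_apply, Matrix.single_apply,
    Matrix.diagonal_apply, Function.update_apply, Pi.one_apply]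
  rcases eq_or_ne a b with rfl | hab
  · by_cases h : a = i
    · simp [h]
    · simp [h, Ne.symm h]
  · rw [if_neg hab, if_neg hab, if_neg (fun h => hab (h.1.symm.trans h.2)), add_zero]

lemma diagonal_mul_one_add_single {n : ℕ} (δ : Fin n → ℝ) (hδ : ∀ i, 0 < δ i) (a b : Fin n)
    (t : ℝ) :
    Matrix.diagonal δ * (1 + Matrix.single a b t) =
      (1 + Matrix.single a b (δ a * t / δ b)) * Matrix.diagonal δ := by
  rw [mul_add, add_mul, mul_one, one_mul]
  congr 1
  ext i j
  rw [Matrix.diagonal_mul, Matrix.mul_diagonal, Matrix.single_apply, Matrix.single_apply]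
  split_ifs with h
  · rw [← h.1, ← h.2, div_mul_cancel₀ _ (hδ b).ne']
  · rw [mul_zero, zero_mul]

lemma circled_mul_oneAddSingle_class {n : ℕ} (i a b : Fin n) :
    letterClass (.circled i) * mk (fun t : Pos => 1 + Matrix.single a b t.1) =
      mk (fun t : Pos => 1 + Matrix.single a b t.1) * letterClass (.circled i) := by
  have hδ : ∀ (s : Pos) (k : Fin n), 0 < Function.update (1 : Fin n → ℝ) i s.1 k := fun s k => by
    rw [Function.update_apply]
    split_ifs
    exacts [s.2, one_pos]
  refine mk_eq_mk
    { toFun := fun p => (⟨Function.update (1 : Fin n → ℝ) i p.1.1 a * p.2.1 /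
        Function.update (1 : Fin n → ℝ) i p.1.1 b, div_pos (mul_pos (hδ _ _) p.2.2) (hδ _ _)⟩, p.1)
      invFun := fun p => (p.2, ⟨Function.update (1 : Fin n → ℝ) i p.2.1 b * p.1.1 /
        Function.update (1 : Fin n → ℝ) i p.2.1 a, div_pos (mul_pos (hδ _ _) p.1.2) (hδ _ _)⟩)
      left_inv := ?_
      right_inv := ?_ } ?_
  · rintro ⟨s, t⟩
    have h1 := (hδ s a).ne'
    have h2 := (hδ s b).ne'
    ext
    · rfl
    · dsimp only
      field_simp
  · rintro ⟨t, s⟩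
    have h1 := (hδ s a).ne'
    have h2 := (hδ s b).ne'
    ext
    · dsimp only
      field_simp
    · rfl
  · rintro ⟨s, t⟩
    dsimp only [Equiv.coe_fn_mk]
    rw [elementaryJacobi_circled, diagonal_mul_one_add_single _ (hδ s)]

lemma commute_mk {M X Y : Type} [Monoid M] {f : X → M} {g : Y → M}
    (h : ∀ x y, f x * g y = g y * f x) : mk f * mk g = mk g * mk f :=
  mk_eq_mk (Equiv.prodComm _ _) fun p => (h p.1 p.2).symm

/-- The classes of the circled letters commute with the classes of all letters. -/
lemma letterClass_circled_commute {n : ℕ} (i : Fin n) (l : Letter n) :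
    Commute (letterClass (.circled i)) (letterClass l) := by
  cases l with
  | unbarred j => exact circled_mul_oneAddSingle_class i _ _
  | barred j => exact circled_mul_oneAddSingle_class i _ _
  | circled j =>
    refine commute_mk fun s t => ?_
    rw [elementaryJacobi_circled, elementaryJacobi_circled, Matrix.diagonal_mul_diagonal,
      Matrix.diagonal_mul_diagonal]
    exact congrArg _ (funext fun _ => mul_comm _ _)

lemma one_add_single_commute {n : ℕ} {a b c d : Fin n} (h1 : b ≠ c) (h2 : d ≠ a) (s t : ℝ) :
    (1 + Matrix.single a b s) * (1 + Matrix.single c d t) =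
      (1 + Matrix.single c d t) * (1 + Matrix.single a b s) := by
  simp only [mul_add, add_mul, one_mul, mul_one, Matrix.single_mul_single_of_ne _ _ _ _ h1,
    Matrix.single_mul_single_of_ne _ _ _ _ h2]
  abel

lemma unbarred_barred_commute {n : ℕ} {i j : Fin (n - 1)} (h : i ≠ j) :
    letterClass (.unbarred i) * letterClass (.barred j) =
      letterClass (.barred j) * letterClass (.unbarred i) :=
  commute_mk fun s t => one_add_single_commute (by simpa [upper, Fin.ext_iff] using h)
    (by simpa [lower, Fin.ext_iff] using h.symm) _ _

lemma unbarred_commute {n : ℕ} {i j : Fin (n - 1)} (h : i.1 + 1 < j.1) :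
    letterClass (.unbarred i) * letterClass (.unbarred j) =
      letterClass (.unbarred j) * letterClass (.unbarred i) :=
  commute_mk fun s t => one_add_single_commute (by simp [upper, lower, Fin.ext_iff]; omega)
    (by simp [lower, upper, Fin.ext_iff]; omega) _ _

lemma barred_commute {n : ℕ} {i j : Fin (n - 1)} (h : i.1 + 1 < j.1) :
    letterClass (.barred i) * letterClass (.barred j) =
      letterClass (.barred j) * letterClass (.barred i) :=
  commute_mk fun s t => one_add_single_commute (by simp [upper, lower, Fin.ext_iff]; omega)
    (by simp [lower, upper, Fin.ext_iff]; omega) _ _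

/-- The parameter change `(a, b, c) ↦ (bc/(a+c), a+c, ab/(a+c))` of a braid move; it is an
involution of the positive octant. -/
noncomputable def braidEquiv : (Pos × Pos) × Pos ≃ (Pos × Pos) × Pos :=
  Function.Involutive.toPerm
    (fun p => ((⟨p.1.2.1 * p.2.1 / (p.1.1.1 + p.2.1),
        div_pos (mul_pos p.1.2.2 p.2.2) (add_pos p.1.1.2 p.2.2)⟩,
      ⟨p.1.1.1 + p.2.1, add_pos p.1.1.2 p.2.2⟩),
      ⟨p.1.1.1 * p.1.2.1 / (p.1.1.1 + p.2.1),
        div_pos (mul_pos p.1.1.2 p.1.2.2) (add_pos p.1.1.2 p.2.2)⟩)) <| by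
    rintro ⟨⟨⟨a, ha⟩, ⟨b, hb⟩⟩, ⟨c, hc⟩⟩
    have h1 : a + c ≠ 0 := (add_pos ha hc).ne'
    have h2 : b * c / (a + c) + a * b / (a + c) = b := by
      field_simp
      ring
    ext
    · simp only [h2]
      field_simp
    · exact h2
    · simp only [h2]
      field_simp

lemma single_eq_smul {n : ℕ} (i j : Fin n) (t : ℝ) :
    Matrix.single i j t = t • Matrix.single i j (1 : ℝ) := by
  rw [Matrix.smul_single, smul_eq_mul, mul_one]

lemma one_add_single_braid {n : ℕ} {i j k : Fin n} (hij : i ≠ j) (hjk : j ≠ k) (hik : i ≠ k)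
    {a b c a' b' c' : ℝ} (h1 : a + c = b') (h2 : b = a' + c') (h3 : a * b = b' * c') :
    (1 + Matrix.single i j a) * (1 + Matrix.single j k b) * (1 + Matrix.single i j c) =
      (1 + Matrix.single j k a') * (1 + Matrix.single i j b') * (1 + Matrix.single j k c') := by
  subst h1 h2
  simp only [mul_add, add_mul, one_mul, mul_one, Matrix.single_mul_single_same,
    Matrix.single_mul_single_of_ne _ _ _ _ hij.symm,
    Matrix.single_mul_single_of_ne _ _ _ _ hjk.symm,
    Matrix.single_mul_single_of_ne _ _ _ _ hik.symm, zero_mul]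
  rw [← mul_add, ← add_mul, h3]
  simp only [Matrix.single_add]
  abel

lemma unbarred_braid {n : ℕ} {i j : Fin (n - 1)} (h : i.1 + 1 = j.1) :
    letterClass (.unbarred i) * letterClass (.unbarred j) * letterClass (.unbarred i) =
      letterClass (.unbarred j) * letterClass (.unbarred i) * letterClass (.unbarred j) := by
  have hl : lower j = upper i := Fin.ext h.symm
  refine mk_eq_mk braidEquiv ?_
  rintro ⟨⟨⟨a, ha⟩, ⟨b, hb⟩⟩, ⟨c, hc⟩⟩
  have h1 : a + c ≠ 0 := (add_pos ha hc).ne'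
  simp only [braidEquiv, elementaryJacobi, hl]
  refine (one_add_single_braid (lower_lt_upper i).ne (hl ▸ (lower_lt_upper j).ne)
    ((lower_lt_upper i).trans (hl ▸ lower_lt_upper j)).ne rfl ?_ ?_).symm
  · change b = b * c / (a + c) + a * b / (a + c)
    field_simp
    ring
  · exact (mul_div_cancel₀ _ h1).symm

lemma barred_braid {n : ℕ} {i j : Fin (n - 1)} (h : i.1 + 1 = j.1) :
    letterClass (.barred i) * letterClass (.barred j) * letterClass (.barred i) =
      letterClass (.barred j) * letterClass (.barred i) * letterClass (.barred j) := by
  have hl : lower j = upper i := Fin.ext h.symm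
  symm
  refine mk_eq_mk braidEquiv ?_
  rintro ⟨⟨⟨a, ha⟩, ⟨b, hb⟩⟩, ⟨c, hc⟩⟩
  have h1 : a + c ≠ 0 := (add_pos ha hc).ne'
  simp only [braidEquiv, elementaryJacobi, hl]
  refine (one_add_single_braid (hl ▸ (lower_lt_upper j).ne') (lower_lt_upper i).ne'
    ((lower_lt_upper i).trans (hl ▸ lower_lt_upper j)).ne' rfl ?_ ?_).symm
  · change b = b * c / (a + c) + a * b / (a + c)
    field_simp
    ring
  · exact (mul_div_cancel₀ _ h1).symm

/-- Swapping `x_i` and `x_{\bar i}` multiplies the torus part by `s = 1 + ab` at `i` and by `s⁻¹`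
at `i + 1`; this is a bijection of the positive parameters. -/
noncomputable def swapEquiv : (Pos × Pos) × (Pos × Pos) ≃ (Pos × Pos) × (Pos × Pos) where
  toFun p := ((⟨p.1.1.1 * (1 + p.2.1.1 * p.2.2.1),
        mul_pos p.1.1.2 (add_pos one_pos (mul_pos p.2.1.2 p.2.2.2))⟩,
      ⟨p.1.2.1 / (1 + p.2.1.1 * p.2.2.1),
        div_pos p.1.2.2 (add_pos one_pos (mul_pos p.2.1.2 p.2.2.2))⟩),
    (⟨p.2.2.1 * (1 + p.2.1.1 * p.2.2.1),
        mul_pos p.2.2.2 (add_pos one_pos (mul_pos p.2.1.2 p.2.2.2))⟩,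
      ⟨p.2.1.1 / (1 + p.2.1.1 * p.2.2.1),
        div_pos p.2.1.2 (add_pos one_pos (mul_pos p.2.1.2 p.2.2.2))⟩))
  invFun p := ((⟨p.1.1.1 / (1 + p.2.1.1 * p.2.2.1),
        div_pos p.1.1.2 (add_pos one_pos (mul_pos p.2.1.2 p.2.2.2))⟩,
      ⟨p.1.2.1 * (1 + p.2.1.1 * p.2.2.1),
        mul_pos p.1.2.2 (add_pos one_pos (mul_pos p.2.1.2 p.2.2.2))⟩),
    (⟨p.2.2.1 * (1 + p.2.1.1 * p.2.2.1),
        mul_pos p.2.2.2 (add_pos one_pos (mul_pos p.2.1.2 p.2.2.2))⟩,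
      ⟨p.2.1.1 / (1 + p.2.1.1 * p.2.2.1),
        div_pos p.2.1.2 (add_pos one_pos (mul_pos p.2.1.2 p.2.2.2))⟩))
  left_inv := by
    rintro ⟨⟨⟨p, hp⟩, ⟨q, hq⟩⟩, ⟨⟨a, ha⟩, ⟨b, hb⟩⟩⟩
    have h1 : 1 + a * b ≠ 0 := (add_pos one_pos (mul_pos ha hb)).ne'
    have h2 : b * (1 + a * b) * (a / (1 + a * b)) = a * b := by
      field_simp
    ext <;> simp only [h2] <;> field_simp
  right_inv := by
    rintro ⟨⟨⟨p, hp⟩, ⟨q, hq⟩⟩, ⟨⟨a, ha⟩, ⟨b, hb⟩⟩⟩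
    have h1 : 1 + a * b ≠ 0 := (add_pos one_pos (mul_pos ha hb)).ne'
    have h2 : b * (1 + a * b) * (a / (1 + a * b)) = a * b := by
      field_simp
    ext <;> simp only [h2] <;> field_simp

lemma circled_circled_unbarred_barred {n : ℕ} (i : Fin (n - 1)) :
    letterClass (.circled (lower i)) * letterClass (.circled (upper i)) *
        (letterClass (.unbarred i) * letterClass (.barred i)) =
      letterClass (.circled (lower i)) * letterClass (.circled (upper i)) *
        (letterClass (.barred i) * letterClass (.unbarred i)) := by
  refine mk_eq_mk swapEquiv ?_
  rintro ⟨⟨⟨p, hp⟩, ⟨q, hq⟩⟩, ⟨⟨a, ha⟩, ⟨b, hb⟩⟩⟩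
  have h1 : 1 + a * b ≠ 0 := (add_pos one_pos (mul_pos ha hb)).ne'
  have hne := (lower_lt_upper i).ne
  simp only [swapEquiv, elementaryJacobi, Equiv.coe_fn_mk]
  generalize lower i = r at *
  generalize upper i = s at *
  simp only [mul_add, add_mul, one_mul, mul_one, Matrix.single_mul_single_same,
    Matrix.single_mul_single_of_ne _ _ _ _ hne, Matrix.single_mul_single_of_ne _ _ _ _ hne.symm]
  obtain ⟨E₁, h₁⟩ : ∃ E, ∀ t : ℝ, Matrix.single r r t = t • E := ⟨_, single_eq_smul r r⟩
  obtain ⟨E₂, h₂⟩ : ∃ E, ∀ t : ℝ, Matrix.single r s t = t • E := ⟨_, single_eq_smul r s⟩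
  obtain ⟨E₃, h₃⟩ : ∃ E, ∀ t : ℝ, Matrix.single s r t = t • E := ⟨_, single_eq_smul s r⟩
  obtain ⟨E₄, h₄⟩ : ∃ E, ∀ t : ℝ, Matrix.single s s t = t • E := ⟨_, single_eq_smul s s⟩
  simp only [h₁, h₂, h₃, h₄, zero_mul, add_zero]
  generalize (1 : Matrix (Fin n) (Fin n) ℝ) = E₀
  match_scalars <;> field_simp <;> ring

/-! ### The family of a factorization scheme does not depend on the scheme -/

/-- The product of the classes of all circled letters. -/
def torusClass (n : ℕ) : FamilyClass (Matrix (Fin n) (Fin n) ℝ) :=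
  ((List.finRange n).map fun i => letterClass (.circled i)).prod

lemma prod_map_circled_eq_of_perm {n : ℕ} {a b : List (Fin n)} (h : a.Perm b) :
    (a.map fun i => letterClass (.circled i)).prod =
      (b.map fun i => letterClass (.circled i)).prod := by
  refine (h.map _).prod_eq' ?_
  refine List.Pairwise.map _ (fun _ _ h => h)
    (List.pairwise_of_forall fun i j => letterClass_circled_commute i (.circled j))

lemma torusClass_commute {n : ℕ} (l : Letter n) : Commute (torusClass n) (letterClass l) :=
  Commute.list_prod_left _ _ fun x hx => by
    obtain ⟨i, -, rfl⟩ := List.mem_map.1 hx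
    exact letterClass_circled_commute i l

/-- In the presence of the full torus, unbarred and barred letters may be interchanged. -/
lemma torusClass_unbarred_barred {n : ℕ} (i j : Fin (n - 1)) :
    torusClass n * (letterClass (.unbarred i) * letterClass (.barred j)) =
      torusClass n * (letterClass (.barred j) * letterClass (.unbarred i)) := by
  rcases eq_or_ne i j with rfl | h
  · have hperm : (List.finRange n).Perm
        ((((List.finRange n).erase (lower i)).erase (upper i)) ++ [lower i, upper i]) := by
      refine (List.perm_cons_erase (List.mem_finRange (lower i))).trans ?_
      refine ((List.perm_cons_erase ((List.mem_erase_of_ne (lower_lt_upper i).ne').2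
        (List.mem_finRange (upper i)))).cons _).trans ?_
      exact List.perm_append_comm (l₁ := [lower i, upper i])
    rw [torusClass, prod_map_circled_eq_of_perm hperm, List.map_append, List.prod_append]
    simp only [List.map_cons, List.map_nil, List.prod_cons, List.prod_nil, mul_one]
    rw [mul_assoc, circled_circled_unbarred_barred, ← mul_assoc]
  · rw [unbarred_barred_commute h]

lemma torusClass_mul_word_mul_barred {n : ℕ} (a : List (Fin (n - 1))) (j : Fin (n - 1)) :
    torusClass n * ((a.map fun i => letterClass (.unbarred i)).prod * letterClass (.barred j)) =
      torusClass n * (letterClass (.barred j) *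
        (a.map fun i => letterClass (.unbarred i)).prod) := by
  induction a with
  | nil => simp
  | cons i a ih =>
    rw [List.map_cons, List.prod_cons, mul_assoc, ← mul_assoc, (torusClass_commute _).eq, mul_assoc,
      ih, ← mul_assoc, ← (torusClass_commute _).eq, mul_assoc, ← mul_assoc (letterClass _),
      ← mul_assoc, torusClass_unbarred_barred]
    simp only [mul_assoc]

/-- The class of a letter, with circled letters dropped. -/
def rootClass {n : ℕ} : Letter n → FamilyClass (Matrix (Fin n) (Fin n) ℝ)
  | .circled _ => 1
  | l => letterClass l

lemma prod_map_letterClass_eq_circled_mul {n : ℕ} (w : List (Letter n)) :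
    (w.map letterClass).prod =
      ((circledPart w).map fun i => letterClass (.circled i)).prod * (w.map rootClass).prod := by
  induction w with
  | nil => simp [circledPart]
  | cons l w ih =>
    have hc : Commute ((circledPart w).map fun i => letterClass (.circled i)).prod
        (letterClass l) := Commute.list_prod_left _ _ fun x hx => by
      obtain ⟨i, -, rfl⟩ := List.mem_map.1 hx
      exact letterClass_circled_commute i l
    rw [List.map_cons, List.prod_cons, ih, ← mul_assoc, ← hc.eq, List.map_cons, List.prod_cons]
    cases l with
    | circled i =>
      rw [hc.eq]
      simp [circledPart, rootClass]
    | unbarred i => simp [circledPart, rootClass, mul_assoc]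
    | barred i => simp [circledPart, rootClass, mul_assoc]

lemma torusClass_mul_prod_rootClass {n : ℕ} (w : List (Letter n)) :
    torusClass n * (w.map rootClass).prod =
      torusClass n * (((barredPart w).map fun i => letterClass (.barred i)).prod *
        ((unbarredPart w).map fun i => letterClass (.unbarred i)).prod) := by
  induction w using List.reverseRecOn with
  | nil => simp [barredPart, unbarredPart]
  | append_singleton w l ih =>
    rw [List.map_append, List.prod_append, ← mul_assoc, ih]
    cases l with
    | circled i => simp [barredPart, unbarredPart, rootClass]
    | unbarred i => simp [barredPart, unbarredPart, rootClass, mul_assoc]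
    | barred i =>
      have hD : Commute (torusClass n)
          ((barredPart w).map fun i => letterClass (.barred i)).prod :=
        Commute.list_prod_right _ _ fun x hx => by
          obtain ⟨i, -, rfl⟩ := List.mem_map.1 hx
          exact torusClass_commute _
      have hb : barredPart (w ++ [.barred i]) = barredPart w ++ [i] := by simp [barredPart]
      have hu : unbarredPart (w ++ [.barred i]) = unbarredPart w := by simp [unbarredPart]
      rw [hb, hu, List.map_append, List.prod_append, ← mul_assoc, hD.eq, mul_assoc, mul_assoc]
      simp only [List.map_cons, List.map_nil, List.prod_cons, List.prod_nil, mul_one, rootClass]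
      rw [torusClass_mul_word_mul_barred, ← mul_assoc, ← hD.eq]
      simp only [mul_assoc]

lemma IsFactorizationScheme.circledPart_perm {n : ℕ} {w : List (Letter n)}
    (hw : IsFactorizationScheme w) : (circledPart w).Perm (List.finRange n) :=
  List.perm_iff_count.2 fun i => by
    rw [hw.circled_once, List.count_eq_one_of_mem (List.nodup_finRange n) (List.mem_finRange i)]

/-- Every factorization scheme has the same family of products, up to reparametrization, as the
scheme made of the circled letters, a standard barred word and a standard unbarred word. -/
theorem IsFactorizationScheme.prod_map_letterClass {n : ℕ} {w : List (Letter n)}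
    (hw : IsFactorizationScheme w) :
    (w.map letterClass).prod = torusClass n *
      (((standardWord n).reverse.map fun i => letterClass (.barred i)).prod *
        ((standardWord n).map fun i => letterClass (.unbarred i)).prod) := by
  have hstd : (standardWord n).length =
      (inversions (wordPerm (standardWord n))).card := by
    rw [length_standardWord, wordPerm_standardWord, card_inversions_revPerm]
  obtain ⟨hu, hul⟩ := isReducedWord_iff.1 hw.unbarred_reduced
  obtain ⟨hb, hbl⟩ := isReducedWord_iff.1 hw.barred_reduced
  have hrev : wordPerm (standardWord n).reverse = Fin.revPerm := by
    rw [wordPerm_reverse, wordPerm_standardWord]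
    rfl
  rw [prod_map_letterClass_eq_circled_mul, prod_map_circled_eq_of_perm hw.circledPart_perm,
    ← torusClass, torusClass_mul_prod_rootClass]
  rw [prod_map_eq_of_reduced (fun i : Fin (n - 1) => letterClass (.unbarred i))
      (fun i j => unbarred_commute) (fun i j => unbarred_braid) (unbarredPart w) (standardWord n)
      (by rw [hu, wordPerm_standardWord]) (by rw [hu, hul]) hstd,
    prod_map_eq_of_reduced (fun i : Fin (n - 1) => letterClass (.barred i))
      (fun i j => barred_commute) (fun i j => barred_braid) (barredPart w) (standardWord n).reverse
      (by rw [hb, hrev]) (by rw [hb, hbl])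
      (by rw [List.length_reverse, hrev, ← wordPerm_standardWord, hstd])]

/-! ### Minors under a column operation -/

lemma IsTotallyPositive.det_pos {n k : ℕ} {x : Matrix (Fin n) (Fin n) ℝ}
    (hx : IsTotallyPositive x) {r c : Fin k → Fin n} (hr : StrictMono r) (hc : StrictMono c) :
    0 < (x.submatrix r c).det :=
  hx k (OrderEmbedding.ofStrictMono r hr) (OrderEmbedding.ofStrictMono c hc)

/-- All minors are nonnegative. -/
def IsTotallyNonneg {n : ℕ} (x : Matrix (Fin n) (Fin n) ℝ) : Prop :=
  ∀ (k : ℕ) (r c : Fin k → Fin n), StrictMono r → StrictMono c → 0 ≤ (x.submatrix r c).det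

lemma IsTotallyNonneg.transpose {n : ℕ} {x : Matrix (Fin n) (Fin n) ℝ} (hx : IsTotallyNonneg x) :
    IsTotallyNonneg x.transpose := fun k r c hr hc => by
  rw [← Matrix.transpose_submatrix, Matrix.det_transpose]
  exact hx k c r hc hr

lemma mul_one_add_single_apply {n : ℕ} (y : Matrix (Fin n) (Fin n) ℝ) (i j : Fin n) (t : ℝ)
    (a b : Fin n) :
    (y * (1 + Matrix.single i j t)) a b = y a b + if b = j then y a i * t else 0 := by
  rw [mul_add, mul_one, Matrix.add_apply]
  split_ifs with h
  · rw [h, Matrix.mul_single_apply_same]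
  · rw [Matrix.mul_single_apply_of_ne _ _ _ _ _ h]

lemma det_submatrix_mul_unbarred {n k : ℕ} (y : Matrix (Fin n) (Fin n) ℝ) (i : Fin (n - 1))
    (t : ℝ) (r c : Fin k → Fin n) (hc : StrictMono c) (p : Fin k) (hp : c p = upper i) :
    ((y * elementaryJacobi (.unbarred i) t).submatrix r c).det =
      (y.submatrix r c).det +
        t * (y.submatrix r (Function.update c p (lower i))).det := by
  have h1 : (y * elementaryJacobi (.unbarred i) t).submatrix r c =
      (y.submatrix r c).updateCol p
        ((fun a => y.submatrix r c a p) + t • fun a => y (r a) (lower i)) := by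
    ext a b
    rw [Matrix.submatrix_apply, elementaryJacobi, mul_one_add_single_apply, Matrix.updateCol_apply]
    by_cases h : b = p
    · simp [h, hp, mul_comm]
    · rw [if_neg h, if_neg (fun h' => h (hc.injective (h'.trans hp.symm)))]
      simp
  have h2 : y.submatrix r (Function.update c p (lower i)) =
      (y.submatrix r c).updateCol p fun a => y (r a) (lower i) := by
    ext a b
    rw [Matrix.updateCol_apply]
    by_cases h : b = p
    · simp [h]
    · simp [h]
  rw [h1, h2, Matrix.det_updateCol_add, Matrix.det_updateCol_smul]
  congr 2
  exact (Matrix.updateCol_eq_self _ _)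

lemma submatrix_mul_unbarred {n k : ℕ} (y : Matrix (Fin n) (Fin n) ℝ) (i : Fin (n - 1))
    (t : ℝ) (r c : Fin k → Fin n) (h : ∀ p, c p ≠ upper i) :
    (y * elementaryJacobi (.unbarred i) t).submatrix r c = y.submatrix r c := by
  ext a b
  rw [Matrix.submatrix_apply, elementaryJacobi, mul_one_add_single_apply, if_neg (h b), add_zero,
    Matrix.submatrix_apply]

lemma strictMono_update_lower {n k : ℕ} {i : Fin (n - 1)} {c : Fin k → Fin n} (hc : StrictMono c)
    {p : Fin k} (hp : c p = upper i) (h : ∀ q, c q ≠ lower i) :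
    StrictMono (Function.update c p (lower i)) := by
  intro a b hab
  have hlt := hc hab
  rw [Function.update_apply, Function.update_apply]
  have hq := h a
  split_ifs with h1 h2 h2
  · exact absurd (h1.trans h2.symm) hab.ne
  · rw [h1, hp] at hlt
    exact (lower_lt_upper i).trans hlt
  · rw [h2, hp] at hlt
    simp only [lower, upper, Fin.lt_def, ne_eq, Fin.ext_iff] at *
    omega
  · exact hlt

/-- A column operation with nonnegative parameter does not decrease the minors of a totally
nonnegative matrix. -/
lemma IsTotallyNonneg.le_det_mul_unbarred {n k : ℕ} {y : Matrix (Fin n) (Fin n) ℝ}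
    (hy : IsTotallyNonneg y) (i : Fin (n - 1)) {t : ℝ} (ht : 0 ≤ t) {r c : Fin k → Fin n}
    (hr : StrictMono r) (hc : StrictMono c) :
    (y.submatrix r c).det ≤ ((y * elementaryJacobi (.unbarred i) t).submatrix r c).det := by
  by_cases h : ∀ p, c p ≠ upper i
  · rw [submatrix_mul_unbarred _ _ _ _ _ h]
  · push Not at h
    obtain ⟨p, hp⟩ := h
    rw [det_submatrix_mul_unbarred y i t r c hc p hp]
    refine le_add_of_nonneg_right (mul_nonneg ht ?_)
    by_cases hl : ∀ q, c q ≠ lower i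
    · exact hy k _ _ hr (strictMono_update_lower hc hp hl)
    · push Not at hl
      obtain ⟨q, hq⟩ := hl
      have hqp : q ≠ p := fun h => (lower_lt_upper i).ne (by rw [← hq, ← hp, h])
      refine (Matrix.det_zero_of_column_eq hqp fun a => ?_).ge
      simp [hqp, hq]

lemma IsTotallyNonneg.mul_unbarred {n : ℕ} {y : Matrix (Fin n) (Fin n) ℝ}
    (hy : IsTotallyNonneg y) (i : Fin (n - 1)) {t : ℝ} (ht : 0 ≤ t) :
    IsTotallyNonneg (y * elementaryJacobi (.unbarred i) t) := fun k r c hr hc =>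
  (hy k r c hr hc).trans (hy.le_det_mul_unbarred i ht hr hc)

/-! ### A run of column operations -/

/-- The product `x_0(μ_0) ⋯ x_{k-1}(μ_{k-1})` in size `m + 1`, for `k ≤ m`. -/
def upperRun {m : ℕ} (μ : Fin m → ℝ) (k : ℕ) (hk : k ≤ m) :
    Matrix (Fin (m + 1)) (Fin (m + 1)) ℝ :=
  (List.ofFn fun i : Fin k =>
    elementaryJacobi (n := m + 1) (.unbarred ⟨i.1, by omega⟩) (μ ⟨i.1, by omega⟩)).prod

lemma upperRun_succ {m : ℕ} (μ : Fin m → ℝ) (k : ℕ) (hk : k + 1 ≤ m) :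
    upperRun μ (k + 1) hk = upperRun μ k (by omega) *
      elementaryJacobi (n := m + 1) (.unbarred ⟨k, by omega⟩) (μ ⟨k, by omega⟩) := by
  rw [upperRun, List.ofFn_succ', List.concat_eq_append, List.prod_append, List.prod_singleton]
  rfl

/-- The unipotent bidiagonal matrix with superdiagonal `-μ`. -/
def bidiagonal {m : ℕ} (μ : Fin m → ℝ) : Matrix (Fin (m + 1)) (Fin (m + 1)) ℝ :=
  fun a b => Fin.cases ((1 : Matrix (Fin (m + 1)) (Fin (m + 1)) ℝ) a 0)
    (fun j => (1 : Matrix (Fin (m + 1)) (Fin (m + 1)) ℝ) a j.succ -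
      (1 : Matrix (Fin (m + 1)) (Fin (m + 1)) ℝ) a j.castSucc * μ j) b

lemma mul_bidiagonal_zero {m : ℕ} (x : Matrix (Fin (m + 1)) (Fin (m + 1)) ℝ) (μ : Fin m → ℝ)
    (a : Fin (m + 1)) : (x * bidiagonal μ) a 0 = x a 0 := by
  simp [Matrix.mul_apply, bidiagonal, Matrix.one_apply]

lemma mul_bidiagonal_succ {m : ℕ} (x : Matrix (Fin (m + 1)) (Fin (m + 1)) ℝ) (μ : Fin m → ℝ)
    (a : Fin (m + 1)) (j : Fin m) :
    (x * bidiagonal μ) a j.succ = x a j.succ - x a j.castSucc * μ j := by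
  simp [Matrix.mul_apply, bidiagonal, Matrix.one_apply, mul_sub, Finset.sum_sub_distrib]

lemma upperRun_apply_zero {m : ℕ} (μ : Fin m → ℝ) (k : ℕ) (hk : k ≤ m) (a : Fin (m + 1)) :
    upperRun μ k hk a 0 = (1 : Matrix (Fin (m + 1)) (Fin (m + 1)) ℝ) a 0 := by
  induction k with
  | zero => simp [upperRun]
  | succ k ih =>
    rw [upperRun_succ, elementaryJacobi, mul_one_add_single_apply, ih,
      if_neg (by simp [upper, Fin.ext_iff]), add_zero]

/-- Each column of a run is built from the one before it. -/
lemma upperRun_apply_succ {m : ℕ} (μ : Fin m → ℝ) (k : ℕ) (hk : k ≤ m) (a : Fin (m + 1))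
    (j : Fin m) :
    upperRun μ k hk a j.succ = (1 : Matrix (Fin (m + 1)) (Fin (m + 1)) ℝ) a j.succ +
      if j.1 < k then upperRun μ k hk a j.castSucc * μ j else 0 := by
  induction k with
  | zero => simp [upperRun]
  | succ k ih =>
    rw [upperRun_succ, elementaryJacobi, mul_one_add_single_apply, mul_one_add_single_apply,
      ih (by omega)]
    have e1 : j.succ = upper (n := m + 1) ⟨k, by omega⟩ ↔ j.1 = k := by simp [upper, Fin.ext_iff]
    have e2 : j.castSucc = upper (n := m + 1) ⟨k, by omega⟩ ↔ j.1 = k + 1 := by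
      simp [upper, Fin.ext_iff]
    simp only [e1, e2]
    rcases lt_trichotomy j.1 k with h | h | h
    · rw [if_pos h, if_neg h.ne, if_neg (show ¬j.1 = k + 1 by omega),
        if_pos (show j.1 < k + 1 by omega), add_zero, add_zero]
    · have e3 : lower (n := m + 1) ⟨k, by omega⟩ = j.castSucc := Fin.ext h.symm
      have e4 : (⟨k, by omega⟩ : Fin m) = j := Fin.ext h.symm
      rw [if_neg (show ¬j.1 < k by omega), if_pos h, if_neg (show ¬j.1 = k + 1 by omega),
        if_pos (show j.1 < k + 1 by omega), e3, e4, add_zero, add_zero]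
    · rw [if_neg (show ¬j.1 < k by omega), if_neg h.ne', if_neg (show ¬j.1 < k + 1 by omega),
        add_zero]

lemma upperRun_mul_bidiagonal {m : ℕ} (μ : Fin m → ℝ) :
    upperRun μ m le_rfl * bidiagonal μ = 1 := by
  ext a b
  induction b using Fin.cases with
  | zero => rw [mul_bidiagonal_zero, upperRun_apply_zero]
  | succ j =>
    rw [mul_bidiagonal_succ, upperRun_apply_succ, if_pos j.2]
    ring

/-- A minor of `y * x_0(μ_0) ⋯ x_{k-1}(μ_{k-1})` is positive if the minor of `y` is, in which the
first column index has been moved down to the first column: the minor of the product is at least a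
positive multiple of it. -/
lemma det_mul_upperRun_pos {m : ℕ} {y : Matrix (Fin (m + 1)) (Fin (m + 1)) ℝ}
    (hy : IsTotallyNonneg y) {μ : Fin m → ℝ} (hμ : ∀ i, 0 < μ i) (k : ℕ) (hk : k ≤ m) :
    IsTotallyNonneg (y * upperRun μ k hk) ∧
      ∀ (l : ℕ) (r c : Fin (l + 1) → Fin (m + 1)), StrictMono r → StrictMono c → (c 0).1 ≤ k →
        0 < (y.submatrix r (Function.update c 0 0)).det →
        0 < ((y * upperRun μ k hk).submatrix r c).det := by
  induction k with
  | zero =>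
    have h1 : upperRun μ 0 hk = 1 := by simp [upperRun]
    rw [h1, mul_one]
    refine ⟨hy, fun l r c _ _ h0 h => ?_⟩
    have : (0 : Fin (m + 1)) = c 0 := Fin.ext (by simp; omega)
    rwa [this, Function.update_eq_self] at h
  | succ k ih =>
    obtain ⟨hnn, hpos⟩ := ih (by omega)
    rw [upperRun_succ, ← mul_assoc]
    refine ⟨hnn.mul_unbarred _ (hμ _).le, fun l r c hr hc h0 h => ?_⟩
    rcases Nat.lt_or_ge k (c 0).1 with hlt | hle
    · have hc0 : c 0 = upper (n := m + 1) ⟨k, by omega⟩ := Fin.ext (by simp [upper]; omega)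
      have hne : ∀ q, c q ≠ lower (n := m + 1) ⟨k, by omega⟩ := fun q hq => by
        have := (lower_lt_upper (n := m + 1) ⟨k, by omega⟩).trans_le
          (hc0 ▸ hc.monotone (Fin.zero_le q))
        exact this.ne hq.symm
      rw [det_submatrix_mul_unbarred _ _ _ r c hc 0 hc0]
      refine add_pos_of_nonneg_of_pos (hnn _ r c hr hc) (mul_pos (hμ _) ?_)
      refine hpos l r _ hr (strictMono_update_lower hc hc0 hne) (by simp [lower]) ?_
      rwa [Function.update_idem]
    · exact (hpos l r c hr hc hle h).trans_le (hnn.le_det_mul_unbarred _ (hμ _).le hr hc)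

/-! ### Bordering by a corner entry -/

/-- The block diagonal matrix with blocks `s` and `z`. -/
def cornerSum {m : ℕ} (s : ℝ) (z : Matrix (Fin m) (Fin m) ℝ) :
    Matrix (Fin (m + 1)) (Fin (m + 1)) ℝ :=
  Fin.cases (Fin.cases s fun _ => 0) fun i => Fin.cases 0 fun j => z i j

@[simp] lemma cornerSum_zero_zero {m : ℕ} (s : ℝ) (z : Matrix (Fin m) (Fin m) ℝ) :
    cornerSum s z 0 0 = s := rfl

@[simp] lemma cornerSum_zero_succ {m : ℕ} (s : ℝ) (z : Matrix (Fin m) (Fin m) ℝ) (j : Fin m) :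
    cornerSum s z 0 j.succ = 0 := rfl

@[simp] lemma cornerSum_succ_zero {m : ℕ} (s : ℝ) (z : Matrix (Fin m) (Fin m) ℝ) (i : Fin m) :
    cornerSum s z i.succ 0 = 0 := rfl

@[simp] lemma cornerSum_succ_succ {m : ℕ} (s : ℝ) (z : Matrix (Fin m) (Fin m) ℝ) (i j : Fin m) :
    cornerSum s z i.succ j.succ = z i j := rfl

lemma exists_eq_succ_comp {k m : ℕ} {r : Fin k → Fin (m + 1)} (hr : StrictMono r)
    (h : ∀ a, r a ≠ 0) : ∃ r' : Fin k → Fin m, StrictMono r' ∧ r = Fin.succ ∘ r' :=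
  ⟨fun q => (r q).pred (h q), fun _ _ hab => Fin.pred_lt_pred_iff.2 (hr hab),
    funext fun _ => (Fin.succ_pred _ _).symm⟩

lemma exists_tail {k m : ℕ} {r : Fin (k + 1) → Fin (m + 1)} (hr : StrictMono r) :
    ∃ r' : Fin k → Fin m, StrictMono r' ∧ ∀ q, r q.succ = (r' q).succ := by
  obtain ⟨r', h, he⟩ := exists_eq_succ_comp
    (hr.comp (Fin.strictMono_succ (n := k))) fun q =>
      ((Fin.zero_le _).trans_lt (hr (Fin.succ_pos q))).ne'
  exact ⟨r', h, fun q => congrFun he q⟩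

/-- A minor of a block sum which involves the first row and the first column. -/
lemma det_cornerSum_submatrix {k m : ℕ} (s : ℝ) (z : Matrix (Fin m) (Fin m) ℝ)
    {r c : Fin (k + 1) → Fin (m + 1)} {r' c' : Fin k → Fin m} (hr : ∀ q, r q.succ = (r' q).succ)
    (hc : ∀ q, c q.succ = (c' q).succ) (hr0 : r 0 = 0) (hc0 : c 0 = 0) :
    ((cornerSum s z).submatrix r c).det = s * (z.submatrix r' c').det := by
  rw [Matrix.det_succ_column_zero, Fin.sum_univ_succ]
  have h : ((cornerSum s z).submatrix r c).submatrix (Fin.succAbove 0) Fin.succ =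
      z.submatrix r' c' := by
    ext a b
    simp [hr, hc]
  rw [h]
  simp [hr, hr0, hc0]

lemma isTotallyNonneg_cornerSum {m : ℕ} {s : ℝ} (hs : 0 < s) {z : Matrix (Fin m) (Fin m) ℝ}
    (hz : IsTotallyPositive z) : IsTotallyNonneg (cornerSum s z) := by
  intro k r c hr hc
  cases k with
  | zero => simp
  | succ k =>
    have hne : ∀ {r : Fin (k + 1) → Fin (m + 1)}, StrictMono r → r 0 ≠ 0 → ∀ q, r q ≠ 0 :=
      fun hr h q hq => h (le_antisymm (hq ▸ hr.monotone (Fin.zero_le q)) (Fin.zero_le _))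
    by_cases hr0 : r 0 = 0 <;> by_cases hc0 : c 0 = 0
    · obtain ⟨r', hr', er⟩ := exists_tail hr
      obtain ⟨c', hc', ec⟩ := exists_tail hc
      rw [det_cornerSum_submatrix s z er ec hr0 hc0]
      exact (mul_pos hs (hz.det_pos hr' hc')).le
    · obtain ⟨c', hc', rfl⟩ := exists_eq_succ_comp hc (hne hc hc0)
      exact (Matrix.det_eq_zero_of_row_eq_zero 0 fun j => by simp [hr0]).ge
    · obtain ⟨r', hr', rfl⟩ := exists_eq_succ_comp hr (hne hr hr0)
      exact (Matrix.det_eq_zero_of_column_eq_zero 0 fun j => by simp [hc0]).ge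
    · obtain ⟨r', hr', rfl⟩ := exists_eq_succ_comp hr (hne hr hr0)
      obtain ⟨c', hc', rfl⟩ := exists_eq_succ_comp hc (hne hc hc0)
      exact (hz.det_pos hr' hc').le

/-- Row and column operations with positive parameters turn the block sum of a positive number and
a totally positive matrix into a totally positive matrix. -/
lemma isTotallyPositive_of_cornerSum {m : ℕ} {s : ℝ} (hs : 0 < s) {z : Matrix (Fin m) (Fin m) ℝ}
    (hz : IsTotallyPositive z) {l μ : Fin m → ℝ} (hl : ∀ i, 0 < l i) (hμ : ∀ i, 0 < μ i) :
    IsTotallyPositive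
      ((upperRun l m le_rfl).transpose * cornerSum s z * upperRun μ m le_rfl) := by
  intro k r c
  cases k with
  | zero => simp
  | succ k =>
    have hr := r.strictMono
    have hc := c.strictMono
    obtain ⟨hnn, hpos⟩ := det_mul_upperRun_pos (isTotallyNonneg_cornerSum hs hz) hμ m le_rfl
    obtain ⟨-, hpos'⟩ := det_mul_upperRun_pos hnn.transpose hl m le_rfl
    rw [mul_assoc, ← Matrix.det_transpose, Matrix.transpose_submatrix, Matrix.transpose_mul,
      Matrix.transpose_transpose]
    refine hpos' k c r hc hr (Nat.le_of_lt_succ (r 0).2) ?_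
    rw [← Matrix.transpose_submatrix, Matrix.det_transpose]
    obtain ⟨r', hr', er⟩ := exists_tail hr
    obtain ⟨c', hc', ec⟩ := exists_tail hc
    have hr0 : StrictMono (Function.update r 0 0) := by
      intro a b hab
      have hb : b ≠ 0 := ((Fin.zero_le a).trans_lt hab).ne'
      rw [Function.update_of_ne hb, Function.update_apply]
      split_ifs
      · exact (Fin.zero_le _).trans_lt (hr hab)
      · exact hr hab
    refine hpos k _ c hr0 hc (Nat.le_of_lt_succ (c 0).2) ?_
    rw [det_cornerSum_submatrix (r' := r') (c' := c') s z (fun q => by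
        rw [Function.update_of_ne (Fin.succ_ne_zero q), er]) (fun q => by
        rw [Function.update_of_ne (Fin.succ_ne_zero q), ec]) (by simp) (by simp)]
    exact mul_pos hs (hz.det_pos hr' hc')

/-! ### Neville elimination -/

/-- The minors on consecutive rows and an initial segment of the columns are positive. -/
def IsColumnInitialPos {n : ℕ} (x : Matrix (Fin n) (Fin n) ℝ) : Prop :=
  ∀ (k a : ℕ) (h : a + k ≤ n),
    0 < (x.submatrix (fun i : Fin k => ⟨a + i.1, by omega⟩) (fun i => ⟨i.1, by omega⟩)).det

lemma IsColumnInitialPos.apply_zero_pos {m : ℕ} {x : Matrix (Fin (m + 1)) (Fin (m + 1)) ℝ}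
    (hx : IsColumnInitialPos x) (i : Fin (m + 1)) : 0 < x i 0 := by
  have := hx 1 i.1 i.2
  rw [Matrix.det_fin_one] at this
  exact this

lemma IsTotallyPositive.transpose {n : ℕ} {x : Matrix (Fin n) (Fin n) ℝ}
    (hx : IsTotallyPositive x) : IsTotallyPositive x.transpose := fun k r c => by
  rw [← Matrix.transpose_submatrix, Matrix.det_transpose]
  exact hx k c r

lemma IsTotallyPositive.isColumnInitialPos {n : ℕ} {x : Matrix (Fin n) (Fin n) ℝ}
    (hx : IsTotallyPositive x) : IsColumnInitialPos x := fun _ a _ =>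
  hx.det_pos (fun _ _ hij => Nat.add_lt_add_left hij a) fun _ _ hij => hij

/-- Double differences of the entries of `x`, with weights `l` on the rows and `μ` on the
columns. -/
def doubleDifference {m : ℕ} (x : Matrix (Fin (m + 1)) (Fin (m + 1)) ℝ) (l μ : Fin m → ℝ) :
    Matrix (Fin m) (Fin m) ℝ := fun i j =>
  x i.succ j.succ - l i * x i.castSucc j.succ -
    μ j * (x i.succ j.castSucc - l i * x i.castSucc j.castSucc)

/-- If the row operations clear the first column below the corner, then the determinant is the
corner entry times the determinant of the double differences; the column weights are arbitrary. -/
lemma det_eq_mul_det_doubleDifference {m : ℕ} (x : Matrix (Fin (m + 1)) (Fin (m + 1)) ℝ)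
    (l μ : Fin m → ℝ) (h : ∀ i : Fin m, x i.succ 0 = l i * x i.castSucc 0) :
    x.det = x 0 0 * (doubleDifference x l μ).det := by
  let y : Matrix (Fin (m + 1)) (Fin (m + 1)) ℝ := fun a b =>
    Fin.cases (x 0 b) (fun i => x i.succ b - l i * x i.castSucc b) a
  let u : Matrix (Fin (m + 1)) (Fin (m + 1)) ℝ := fun a b =>
    Fin.cases (y a 0) (fun j => y a j.succ - μ j * y a j.castSucc) b
  have h1 : x.det = y.det :=
    Matrix.det_eq_of_forall_row_eq_smul_add_pred l (fun _ => rfl) fun i j =>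
      (sub_add_cancel _ _).symm
  have h2 : y.det = u.det :=
    Matrix.det_eq_of_forall_col_eq_smul_add_pred μ (fun _ => rfl) fun i j =>
      (sub_add_cancel _ _).symm
  have h3 : ∀ i : Fin m, u i.succ 0 = 0 := fun i => sub_eq_zero.2 (h i)
  rw [h1, h2, Matrix.det_succ_column_zero, Fin.sum_univ_succ]
  simp only [h3, mul_zero, zero_mul, Finset.sum_const_zero, add_zero, Fin.val_zero, pow_zero,
    one_mul]
  rfl

lemma doubleDifference_transpose {m : ℕ} (x : Matrix (Fin (m + 1)) (Fin (m + 1)) ℝ)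
    (l μ : Fin m → ℝ) :
    (doubleDifference x l μ).transpose = doubleDifference x.transpose μ l := by
  ext i j
  simp only [doubleDifference, Matrix.transpose_apply]
  ring

lemma IsColumnInitialPos.doubleDifference {m : ℕ} {x : Matrix (Fin (m + 1)) (Fin (m + 1)) ℝ}
    (hx : IsColumnInitialPos x) {l : Fin m → ℝ} (μ : Fin m → ℝ)
    (h : ∀ i : Fin m, x i.succ 0 = l i * x i.castSucc 0) :
    IsColumnInitialPos (doubleDifference x l μ) := by
  intro k a hak
  have hX := hx (k + 1) a (by omega)
  rw [det_eq_mul_det_doubleDifference _ (fun i : Fin k => l ⟨a + i.1, by omega⟩)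
    (fun j : Fin k => μ ⟨j.1, by omega⟩) fun i => h ⟨a + i.1, by omega⟩] at hX
  exact pos_of_mul_pos_right hX (hx.apply_zero_pos ⟨a, by omega⟩).le

lemma bidiagonal_transpose_mul_mul_bidiagonal {m : ℕ}
    (x : Matrix (Fin (m + 1)) (Fin (m + 1)) ℝ) (l μ : Fin m → ℝ) :
    let y := (bidiagonal l).transpose * x * bidiagonal μ
    y 0 0 = x 0 0 ∧ (∀ i, y (Fin.succ i) 0 = x i.succ 0 - l i * x i.castSucc 0) ∧
      (∀ j, y 0 (Fin.succ j) = x 0 j.succ - μ j * x 0 j.castSucc) ∧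
      ∀ i j, y (Fin.succ i) (Fin.succ j) = doubleDifference x l μ i j := by
  have h0 : ∀ b, ((bidiagonal l).transpose * x) 0 b = x 0 b := fun b => by
    rw [← Matrix.transpose_apply (_ * _), Matrix.transpose_mul, Matrix.transpose_transpose,
      mul_bidiagonal_zero, Matrix.transpose_apply]
  have hs : ∀ i b, ((bidiagonal l).transpose * x) (Fin.succ i) b =
      x i.succ b - l i * x i.castSucc b := fun i b => by
    rw [← Matrix.transpose_apply (_ * _), Matrix.transpose_mul, Matrix.transpose_transpose,
      mul_bidiagonal_succ, Matrix.transpose_apply, Matrix.transpose_apply, mul_comm]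
  refine ⟨?_, fun i => ?_, fun j => ?_, fun i j => ?_⟩
  · rw [mul_bidiagonal_zero, h0]
  · rw [mul_bidiagonal_zero, hs]
  · rw [mul_bidiagonal_succ, h0, h0, mul_comm]
  · rw [mul_bidiagonal_succ, hs, hs, mul_comm _ (μ j), doubleDifference]

/-- Neville elimination: neighbouring rows and columns are subtracted with the multipliers `l` and
`μ` to clear the first column and the first row. -/
lemma eq_mul_cornerSum_mul {m : ℕ} {x : Matrix (Fin (m + 1)) (Fin (m + 1)) ℝ} {l μ : Fin m → ℝ}
    (hl : ∀ i : Fin m, x i.succ 0 = l i * x i.castSucc 0)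
    (hμ : ∀ j : Fin m, x 0 j.succ = μ j * x 0 j.castSucc) :
    x = (upperRun l m le_rfl).transpose * cornerSum (x 0 0) (doubleDifference x l μ) *
      upperRun μ m le_rfl := by
  have h : (bidiagonal l).transpose * x * bidiagonal μ =
      cornerSum (x 0 0) (doubleDifference x l μ) := by
    obtain ⟨h1, h2, h3, h4⟩ := bidiagonal_transpose_mul_mul_bidiagonal x l μ
    ext a b
    induction a using Fin.cases <;> induction b using Fin.cases
    · rw [h1, cornerSum_zero_zero]
    · rw [h3, cornerSum_zero_succ, hμ, sub_self]
    · rw [h2, cornerSum_succ_zero, hl, sub_self]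
    · rw [h4, cornerSum_succ_succ]
  have e1 : (upperRun l m le_rfl).transpose * (bidiagonal l).transpose = 1 := by
    rw [← Matrix.transpose_mul, mul_eq_one_comm.1 (upperRun_mul_bidiagonal l),
      Matrix.transpose_one]
  rw [← h, mul_assoc, mul_assoc _ (bidiagonal μ),
    mul_eq_one_comm.1 (upperRun_mul_bidiagonal μ), mul_one, ← mul_assoc, e1, one_mul]

/-- A matrix whose initial minors (consecutive rows and first columns, or first rows and consecutive
columns) are positive is totally positive. Elimination preserves positivity of the initial minors,
but not visibly that of all minors, so the induction runs over initial minors. -/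
theorem isTotallyPositive_of_isColumnInitialPos {n : ℕ} {x : Matrix (Fin n) (Fin n) ℝ}
    (hx : IsColumnInitialPos x) (hx' : IsColumnInitialPos x.transpose) :
    IsTotallyPositive x := by
  induction n with
  | zero =>
    intro k r c
    have : IsEmpty (Fin k) := ⟨fun i => (r i).elim0⟩
    simp
  | succ m ih =>
    have hc := hx.apply_zero_pos
    have hr : ∀ j, 0 < x 0 j := hx'.apply_zero_pos
    have hl : ∀ i : Fin m, x i.succ 0 = x i.succ 0 / x i.castSucc 0 * x i.castSucc 0 := fun i =>
      (div_mul_cancel₀ _ (hc _).ne').symm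
    have hμ : ∀ j : Fin m, x 0 j.succ = x 0 j.succ / x 0 j.castSucc * x 0 j.castSucc := fun j =>
      (div_mul_cancel₀ _ (hr _).ne').symm
    rw [eq_mul_cornerSum_mul hl hμ]
    refine isTotallyPositive_of_cornerSum (hc 0) (ih (hx.doubleDifference _ hl) ?_)
      (fun i => div_pos (hc _) (hc _)) (fun j => div_pos (hr _) (hr _))
    rw [doubleDifference_transpose]
    exact hx'.doubleDifference _ hμ

/-- One round of Neville elimination: the totally positive matrices of size `m + 1` are
parametrized by the multipliers of the first column and of the first row, the corner entry, and a
totally positive matrix of size `m`. -/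
theorem bijective_elimination (m : ℕ) :
    Function.Bijective fun p : (((Fin m → Pos) × Pos) ×
        {z : Matrix (Fin m) (Fin m) ℝ // IsTotallyPositive z}) × (Fin m → Pos) =>
      (⟨(upperRun (fun i => (p.1.1.1 i).1) m le_rfl).transpose * cornerSum p.1.1.2.1 p.1.2.1 *
        upperRun (fun i => (p.2 i).1) m le_rfl,
        isTotallyPositive_of_cornerSum p.1.1.2.2 p.1.2.2 (fun i => (p.1.1.1 i).2)
          fun i => (p.2 i).2⟩ :
        {x : Matrix (Fin (m + 1)) (Fin (m + 1)) ℝ // IsTotallyPositive x}) := by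
  constructor
  · -- the parameters are read off from the first column, the first row and double differences
    have key : ∀ (x : Matrix (Fin (m + 1)) (Fin (m + 1)) ℝ) (l μ : Fin m → ℝ) (s : ℝ)
        (z : Matrix (Fin m) (Fin m) ℝ), IsTotallyPositive x →
        (upperRun l m le_rfl).transpose * cornerSum s z * upperRun μ m le_rfl = x →
        (∀ i, l i = x i.succ 0 / x i.castSucc 0) ∧ (∀ j, μ j = x 0 j.succ / x 0 j.castSucc) ∧
          s = x 0 0 ∧ z = doubleDifference x l μ := by
      intro x l μ s z hx hxe
      have h : (bidiagonal l).transpose * x * bidiagonal μ = cornerSum s z := by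
        have e1 : (bidiagonal l).transpose * (upperRun l m le_rfl).transpose = 1 := by
          rw [← Matrix.transpose_mul, upperRun_mul_bidiagonal, Matrix.transpose_one]
        rw [← hxe, mul_assoc, mul_assoc _ (upperRun μ m le_rfl), upperRun_mul_bidiagonal, mul_one,
          ← mul_assoc, e1, one_mul]
      obtain ⟨h1, h2, h3, h4⟩ := bidiagonal_transpose_mul_mul_bidiagonal x l μ
      rw [h] at h1 h2 h3 h4
      have hc := hx.isColumnInitialPos.apply_zero_pos
      have hr : ∀ j, 0 < x 0 j := hx.transpose.isColumnInitialPos.apply_zero_pos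
      refine ⟨fun i => (eq_div_iff (hc _).ne').2 (sub_eq_zero.1 (h2 i).symm).symm,
        fun j => (eq_div_iff (hr _).ne').2 (sub_eq_zero.1 (h3 j).symm).symm, h1, ?_⟩
      ext i j
      exact h4 i j
    rintro ⟨⟨⟨l, s⟩, z⟩, μ⟩ ⟨⟨⟨l', s'⟩, z'⟩, μ'⟩ h
    obtain ⟨a1, a2, a3, a4⟩ := key _ _ _ _ _ (isTotallyPositive_of_cornerSum s.2 z.2
      (fun i => (l i).2) fun i => (μ i).2) rfl
    obtain ⟨b1, b2, b3, b4⟩ := key _ _ _ _ _ (isTotallyPositive_of_cornerSum s.2 z.2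
      (fun i => (l i).2) fun i => (μ i).2) (congrArg Subtype.val h).symm
    obtain rfl : l = l' := funext fun i => Subtype.ext ((a1 i).trans (b1 i).symm)
    obtain rfl : μ = μ' := funext fun i => Subtype.ext ((a2 i).trans (b2 i).symm)
    obtain rfl : s = s' := Subtype.ext (a3.trans b3.symm)
    obtain rfl : z = z' := Subtype.ext (a4.trans b4.symm)
    rfl
  · rintro ⟨x, hx⟩
    have hc := hx.isColumnInitialPos.apply_zero_pos
    have hr : ∀ j, 0 < x 0 j := hx.transpose.isColumnInitialPos.apply_zero_pos
    have hl : ∀ i : Fin m, x i.succ 0 = x i.succ 0 / x i.castSucc 0 * x i.castSucc 0 := fun i =>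
      (div_mul_cancel₀ _ (hc _).ne').symm
    have hμ : ∀ j : Fin m, x 0 j.succ = x 0 j.succ / x 0 j.castSucc * x 0 j.castSucc := fun j =>
      (div_mul_cancel₀ _ (hr _).ne').symm
    refine ⟨(((fun i => ⟨_, div_pos (hc i.succ) (hc i.castSucc)⟩, ⟨x 0 0, hc 0⟩),
      ⟨_, isTotallyPositive_of_isColumnInitialPos (hx.isColumnInitialPos.doubleDifference _ hl)
        ?_⟩), fun j => ⟨_, div_pos (hr j.succ) (hr j.castSucc)⟩),
      Subtype.ext (eq_mul_cornerSum_mul hl hμ).symm⟩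
    rw [doubleDifference_transpose]
    exact hx.transpose.isColumnInitialPos.doubleDifference _ hμ

/-! ### The standard scheme -/

/-- The embedding of matrices of size `m` as the lower right block in size `m + 1`. -/
def blockHom (m : ℕ) : Matrix (Fin m) (Fin m) ℝ →* Matrix (Fin (m + 1)) (Fin (m + 1)) ℝ where
  toFun := cornerSum 1
  map_one' := by
    ext a b
    induction a using Fin.cases <;> induction b using Fin.cases <;>
      simp [Matrix.one_apply, Fin.succ_ne_zero, (Fin.succ_ne_zero _).symm]
  map_mul' y z := by
    ext a b
    induction a using Fin.cases <;> induction b using Fin.cases <;>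
      simp [Matrix.mul_apply, Fin.sum_univ_succ]

lemma blockHom_one_add_single {m : ℕ} (i j : Fin m) (t : ℝ) :
    blockHom m (1 + Matrix.single i j t) = 1 + Matrix.single i.succ j.succ t := by
  ext a b
  induction a using Fin.cases <;> induction b using Fin.cases <;>
    simp [blockHom, Matrix.one_apply, Matrix.single_apply, Fin.succ_ne_zero,
      (Fin.succ_ne_zero _).symm]

lemma map_blockHom_letterClass_unbarred {m : ℕ} (i : Fin (m - 1)) :
    map (blockHom m) (letterClass (.unbarred i)) =
      letterClass (n := m + 1) (.unbarred ⟨i.1 + 1, by omega⟩) := by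
  refine (map_mk _ _).trans (congrArg mk (funext fun t => ?_))
  exact blockHom_one_add_single _ _ _

lemma map_blockHom_letterClass_barred {m : ℕ} (i : Fin (m - 1)) :
    map (blockHom m) (letterClass (.barred i)) =
      letterClass (n := m + 1) (.barred ⟨i.1 + 1, by omega⟩) := by
  refine (map_mk _ _).trans (congrArg mk (funext fun t => ?_))
  exact blockHom_one_add_single _ _ _

lemma map_blockHom_letterClass_circled {m : ℕ} (i : Fin m) :
    map (blockHom m) (letterClass (.circled i)) = letterClass (.circled i.succ) := by
  refine (map_mk _ _).trans (congrArg mk (funext fun t => ?_))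
  exact blockHom_one_add_single _ _ _

lemma torusClass_succ (m : ℕ) :
    torusClass (m + 1) = letterClass (.circled 0) * map (blockHom m) (torusClass m) := by
  simp only [torusClass, List.finRange_succ, List.map_cons, List.prod_cons, map_list_prod,
    List.map_map, Function.comp_def, map_blockHom_letterClass_circled]

lemma elementaryJacobi_circled_zero_mul_blockHom {m : ℕ} (s : ℝ) (z : Matrix (Fin m) (Fin m) ℝ) :
    elementaryJacobi (.circled 0) s * blockHom m z = cornerSum s z := by
  rw [elementaryJacobi_circled]
  ext a b
  rw [Matrix.diagonal_mul]
  induction a using Fin.cases <;> induction b using Fin.cases <;> simp [blockHom]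

lemma prod_reverse_ofFn_mk {M X : Type} [Monoid M] {k : ℕ} (f : Fin k → X → M) :
    (List.ofFn fun i => mk (f i)).reverse.prod =
      mk fun t : Fin k → X => (List.ofFn fun i => f i (t i)).reverse.prod := by
  induction k with
  | zero =>
    rw [List.ofFn_zero, List.reverse_nil, List.prod_nil, one_def]
    exact mk_eq_mk (Equiv.ofUnique _ _) fun _ => by simp
  | succ k ih =>
    rw [List.ofFn_succ, List.reverse_cons, List.prod_append, List.prod_singleton, ih, mk_mul_mk]
    exact mk_eq_mk ((Equiv.prodComm _ _).trans (Fin.consEquiv fun _ => X)) fun p => by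
      simp [List.ofFn_succ, Fin.consEquiv]

lemma prod_unbarred_run (m : ℕ) :
    (List.ofFn fun i : Fin m => letterClass (n := m + 1) (.unbarred ⟨i.1, by omega⟩)).prod =
      mk fun μ : Fin m → Pos => upperRun (fun i => (μ i).1) m le_rfl :=
  prod_ofFn_mk _

lemma prod_barred_run (m : ℕ) :
    (List.ofFn fun i : Fin m =>
        letterClass (n := m + 1) (.barred ⟨i.1, by omega⟩)).reverse.prod =
      mk fun l : Fin m → Pos => (upperRun (fun i => (l i).1) m le_rfl).transpose := by
  refine (prod_reverse_ofFn_mk _).trans (congrArg mk (funext fun l => ?_))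
  rw [upperRun, Matrix.transpose_list_prod, List.map_ofFn]
  congr 3
  funext i
  simp [elementaryJacobi]

/-- The standard scheme parametrizes the totally positive matrices bijectively. -/
theorem standardScheme_class (n : ℕ) :
    torusClass n * (((standardWord n).reverse.map fun i => letterClass (.barred i)).prod *
        ((standardWord n).map fun i => letterClass (.unbarred i)).prod) =
      mk fun x : {x : Matrix (Fin n) (Fin n) ℝ // IsTotallyPositive x} => x.1 := by
  induction n with
  | zero =>
    have h : ∀ x : Matrix (Fin 0) (Fin 0) ℝ, IsTotallyPositive x := fun x k r c => by
      have : IsEmpty (Fin k) := ⟨fun i => (r i).elim0⟩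
      simp
    have : Unique {x : Matrix (Fin 0) (Fin 0) ℝ // IsTotallyPositive x} :=
      { default := ⟨0, h 0⟩, uniq := fun _ => Subsingleton.elim _ _ }
    simp only [torusClass, standardWord, List.finRange_zero, List.map_nil, List.reverse_nil,
      List.prod_nil, mul_one]
    rw [one_def]
    exact mk_eq_mk (Equiv.ofUnique _ _) fun _ => Subsingleton.elim _ _
  | succ m ih =>
    have hU : ((standardWord (m + 1)).map fun i => letterClass (.unbarred i)).prod =
        map (blockHom m) ((standardWord m).map fun i => letterClass (.unbarred i)).prod *
          mk fun μ : Fin m → Pos => upperRun (fun i => (μ i).1) m le_rfl := by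
      rw [standardWord, List.map_append, List.prod_append, List.map_ofFn, ← prod_unbarred_run,
        map_list_prod, List.map_map, List.map_map]
      simp only [Function.comp_def, map_blockHom_letterClass_unbarred]
    have hD : ((standardWord (m + 1)).reverse.map fun i => letterClass (.barred i)).prod =
        (mk fun l : Fin m → Pos => (upperRun (fun i => (l i).1) m le_rfl).transpose) *
          map (blockHom m)
            ((standardWord m).reverse.map fun i => letterClass (.barred i)).prod := by
      rw [standardWord, List.reverse_append, List.map_append, List.prod_append, List.map_reverse,
        List.map_ofFn, ← prod_barred_run, map_list_prod, ← List.map_reverse, List.map_map,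
        List.map_map]
      simp only [Function.comp_def, map_blockHom_letterClass_barred]
    have hcomm : Commute (torusClass (m + 1))
        (mk fun l : Fin m → Pos => (upperRun (fun i => (l i).1) m le_rfl).transpose) := by
      rw [← prod_barred_run]
      refine Commute.list_prod_right _ _ fun x hx => ?_
      obtain ⟨i, rfl⟩ := List.mem_ofFn.1 (List.mem_reverse.1 hx)
      exact torusClass_commute _
    -- the barred run is moved in front of the torus, so that the scheme of size `m` is enclosed
    rw [hU, hD, mul_assoc, ← mul_assoc, hcomm.eq, torusClass_succ, mul_assoc, mul_assoc,
      ← mul_assoc (map _ _) (map _ _), ← map_mul, ← mul_assoc (map _ _) (map _ _), ← map_mul,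
      mul_assoc (torusClass m), ih, map_mk, ← mul_assoc, ← mul_assoc, letterClass, mk_mul_mk,
      mk_mul_mk, mk_mul_mk]
    refine mk_eq_mk (Equiv.ofBijective _ (bijective_elimination m)) fun p => ?_
    simp only [Equiv.ofBijective_apply]
    rw [mul_assoc _ _ (blockHom m _), elementaryJacobi_circled_zero_mul_blockHom]

lemma length_eq_add {n : ℕ} (w : List (Letter n)) :
    w.length = (unbarredPart w).length + (barredPart w).length + (circledPart w).length := by
  induction w with
  | nil => rfl
  | cons l w ih =>
    cases l <;> simp [unbarredPart, barredPart, circledPart] at ih ⊢ <;> omega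

lemma IsFactorizationScheme.length_eq {n : ℕ} {w : List (Letter n)}
    (hw : IsFactorizationScheme w) : w.length = n ^ 2 := by
  rw [length_eq_add, (isReducedWord_iff.1 hw.unbarred_reduced).2,
    (isReducedWord_iff.1 hw.barred_reduced).2, card_inversions_revPerm,
    hw.circledPart_perm.length_eq, List.length_finRange, Nat.choose_two_right]
  have := Nat.div_mul_cancel (Nat.even_mul_pred_self n).two_dvd
  cases n with
  | zero => rfl
  | succ m =>
    simp only [Nat.add_sub_cancel] at this ⊢
    nlinarith

end TotalPositivity

theorem mainTheorem5 (n : ℕ) (w : List (TotalPositivity.Letter n))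
    (hw : TotalPositivity.IsFactorizationScheme w) :
    w.length = n ^ 2 ∧
      Set.BijOn (TotalPositivity.productMap (R := ℝ) w)
        {t : Fin w.length → ℝ | ∀ k, 0 < t k}
        {x : Matrix (Fin n) (Fin n) ℝ | TotalPositivity.IsTotallyPositive x} := by
  refine ⟨hw.length_eq, ?_⟩
  have h := (TotalPositivity.prod_map_letterClass w).symm.trans
    (hw.prod_map_letterClass.trans (TotalPositivity.standardScheme_class n))
  obtain ⟨e, he⟩ := TotalPositivity.FamilyClass.mk_eq_mk_iff.1 h
  refine ⟨fun t ht => ?_, fun t ht t' ht' htt => ?_, fun x hx => ?_⟩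
  · exact he ⟨t, ht⟩ ▸ (e ⟨t, ht⟩).2
  · have : e ⟨t, ht⟩ = e ⟨t', ht'⟩ :=
      Subtype.ext ((he ⟨t, ht⟩).trans (htt.trans (he ⟨t', ht'⟩).symm))
    exact congrArg Subtype.val (e.injective this)
  · refine ⟨(e.symm ⟨x, hx⟩).1, (e.symm ⟨x, hx⟩).2, ?_⟩
    rw [← he, e.apply_symm_apply]
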